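/- Setting. Let $K$ be a transitive set such that $(K,\in)$ satisfies $\mathrm{ZFC}$ without the power set axiom (choice in the form of the well-ordering theorem), and such that $K$ computes $\omega_1$ correctly, i.e. $\omega_1\in K$ and every countable ordinal is countable in $K$. Let $\mathcal K=(K,\in,\dots)$ be an expansion of $(K,\in)$ by arbitrary further functions and predicates, and let $\theta$ be the set of ordinals in $K$. Let $\mathcal S$ be a collection of countable elementary submodels of $\mathcal K$ and $\mathcal T$ a collection of transitive $W\prec\mathcal K$ with $W\in K$, and suppose that $M\cap W\in\mathcal S$ and $M\cap W\in W$ for all $M\in\mathcal S$, $W\in\mathcal T$. Let $\mathcal S^*$ (resp. $\mathcal T^*$) be the set of all members of $\mathcal S$ (resp. $\mathcal T$) that are elementary in $\mathcal K^*=(K,\in,\mathcal S,\mathcal T,\dots)$. The poset $\mathbb M^*_{\mathcal S,\mathcal T}$. A condition is a pair $p=(\mathcal M_p,d_p)$ with the following properties. * $\mathcal M_p=\{M_0,\dots,M_{n-1}\}\subseteq\mathcal S\cup\mathcal T$ is a finite $\in$-chain ($M_k\in M_{k+1}$ for $k+1<n$) that is closed under intersection of two elements. Its members are called the nodes of $p$;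 those in $\mathcal S$ are the small nodes, those in $\mathcal T$ the transitive nodes. * $d_p:\mathcal M_p\to K$, every $d_p(M)$ is a finite set, and $d_p(M_k)\in M_{k+1}$ for $k+1<n$. We put $d_p(M)=\emptyset$ for $M\notin\mathcal M_p$. * For all small nodes $M,N$ of $p$, if $N\cap\omega_1\in M$ then $\operatorname{otp}(N\cap\theta)\in M$. The height function $h_p$ is the partial function on $\theta\times\omega_1$ whose domain is the set of all $(\alpha,\xi)$ such that $\alpha\in M$ and $M\cap\omega_1=\xi$ for some small node $M$ of $p$; its value $h_p(\alpha,\xi)$ is the maximum of $\operatorname{otp}(M\cap\theta)$ over all such $M$. We let $q\le p$ if $\mathcal M_p\subseteq\mathcal M_q$, $d_p(M)\subseteq d_q(M)$ for all $M\in\mathcal M_p$, and $h_p\subseteq h_q$. Reflections. Let $p$ be a condition and $Q$ a node of $p$ with $Q\in\mathcal S^*\cup\mathcal T^*$. A reflection of $p$ inside $Q$ is a condition $q\in\mathbb M^*_{\mathcal S,\mathcal T}$ with $q\in Q$ such that $\mathcal M_p\cap Q\subseteq\mathcal M_q$, $d_p(R)\subseteq d_q(R)$ for all $R\in\mathcal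 M_q\cap Q$, and $h_q$ extends $h_p\restriction Q$, the restriction of $h_p$ to the pairs $(\alpha,\xi)\in\operatorname{dom}(h_p)\cap Q$. Lemma. Let $p\in\mathbb M^*_{\mathcal S,\mathcal T}$, let $Q$ be a node of $p$ with $Q\in\mathcal S^*\cup\mathcal T^*$, and let $q$ be a reflection of $p$ inside $Q$. Then there is $r\in\mathbb M^*_{\mathcal S,\mathcal T}$ with $r\le p$ and $r\le q$ such that: 1. $\mathcal M_r$ is the closure of $\mathcal M_p\cup\mathcal M_q$ under intersection; 2. $\mathcal M_r\cap Q=\mathcal M_q$; 3. every small node of $r$ that is not an element of $Q$ is of the form $M$ or $M\cap W$, where $M$ is a small node of $p$ and $W$ is a transitive node of $q$. -/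

import Mathlib

open FirstOrder
open scoped Ordinal

/-! # Side conditions with models of two types

The ambient universe of sets is Mathlib's `ZFSet.{u}`; ordinals are identified with von Neumann
ordinals through `Ordinal.toZFSet`. -/

universe u v w

namespace TwoTypes

/-- The underlying type of the set `K`. -/
abbrev Carrier (K : ZFSet.{u}) : Type (u + 1) := {x : ZFSet.{u} // x ∈ K}

/-- The only symbol of the language of set theory, the binary relation symbol for membership. -/
inductive SetRel : ℕ → Type
  | mem : SetRel 2

/-- The language of set theory. -/
def setLang : FirstOrder.Language.{0, 0} := ⟨fun _ => Empty, SetRel⟩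

/-- The structure `(K, ∈)`. -/
instance membershipStructure (K : ZFSet.{u}) : setLang.Structure (Carrier K) where
  funMap := fun f => Empty.elim f
  RelMap := fun {_} r => match r with
    | SetRel.mem => fun x => (x 0).1 ∈ (x 1).1

/-- Two unary predicate symbols. -/
inductive StarRel : ℕ → Type
  | small : StarRel 1
  | trans : StarRel 1

/-- The language with the two unary predicate symbols `small` and `trans`. -/
def starLang : FirstOrder.Language.{0, 0} := ⟨fun _ => Empty, StarRel⟩

/-- The interpretation of the two predicates on `K` by the families `S` and `T`. -/
abbrev starStructure (K : ZFSet.{u}) (S T : Set ZFSet.{u}) : starLang.Structure (Carrier K) where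
  funMap := fun f => Empty.elim f
  RelMap := fun {_} r => match r with
    | StarRel.small => fun x => (x 0).1 ∈ S
    | StarRel.trans => fun x => (x 0).1 ∈ T

/-- The language of `𝒦 = (K, ∈, …)`, where the additional functions and predicates
are those of the language `L`. -/
abbrev modelLang (L : FirstOrder.Language.{v, w}) : FirstOrder.Language.{v, w} := setLang.sum L

/-- `M ≺ 𝒦 = (K, ∈, …)`. -/
def IsElem (L : FirstOrder.Language.{v, w}) (K : ZFSet.{u}) [L.Structure (Carrier K)] (M : ZFSet.{u}) :
    Prop :=
  M ⊆ K ∧ ∃ E : (modelLang L).ElementarySubstructure (Carrier K),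
    (E : Set (Carrier K)) = {x | x.1 ∈ M}

/-- `M ≺ 𝒦* = (K, ∈, S, T, …)`. -/
def IsElemStar (L : FirstOrder.Language.{v, w}) (K : ZFSet.{u}) [L.Structure (Carrier K)]
    (S T : Set ZFSet.{u}) (M : ZFSet.{u}) : Prop :=
  letI : starLang.Structure (Carrier K) := starStructure K S T
  M ⊆ K ∧ ∃ E : ((modelLang L).sum starLang).ElementarySubstructure (Carrier K),
    (E : Set (Carrier K)) = {x | x.1 ∈ M}

/-- Some element of `K` is an injective function from `a` to `b`. -/
def InjIn (K a b : ZFSet.{u}) : Prop :=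
  ∃ f ∈ K, ZFSet.IsFunc a b f ∧
    ∀ x x' y, ZFSet.pair x y ∈ f → ZFSet.pair x' y ∈ f → x = x'

/-- The set `ω₁`. -/
noncomputable def omegaOne : ZFSet.{u} := (ω₁ : Ordinal.{u}).toZFSet

/-- `K` is a transitive model of `ZFC` without the power set axiom (with choice in the form of the
well-ordering theorem). Extensionality and foundation hold in every transitive set. -/
structure IsTransitiveModel (K : ZFSet.{u}) : Prop where
  transitive : K.IsTransitive
  pairing : ∀ a ∈ K, ∀ b ∈ K, ({a, b} : ZFSet.{u}) ∈ K
  union : ∀ a ∈ K, (ZFSet.sUnion a : ZFSet.{u}) ∈ K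
  infinity : (ω : Ordinal.{u}).toZFSet ∈ K
  separation : ∀ D : Set (Carrier K), (Set.univ : Set (Carrier K)).Definable₁ setLang D →
    ∀ a ∈ K, ∃ b ∈ K, ∀ x : Carrier K, x.1 ∈ b ↔ x.1 ∈ a ∧ x ∈ D
  replacement : ∀ R : Set (Carrier K × Carrier K),
    (Set.univ : Set (Carrier K)).Definable₂ setLang R →
    ∀ a ∈ K, (∀ x : Carrier K, x.1 ∈ a → ∃! y, (x, y) ∈ R) →
      ∃ b ∈ K, ∀ y : Carrier K, y.1 ∈ b ↔ ∃ x : Carrier K, x.1 ∈ a ∧ (x, y) ∈ R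
  choice : ∀ a ∈ K, ∃ o ∈ K, o.IsOrdinal ∧ InjIn K a o

/-- `K` computes `ω₁` correctly: `ω₁ ∈ K` and every countable ordinal is countable in `K`. -/
def CorrectOmegaOne (K : ZFSet.{u}) : Prop :=
  omegaOne ∈ K ∧ ∀ a ∈ (omegaOne : ZFSet.{u}), InjIn K a (ω : Ordinal.{u}).toZFSet

/-- `S` is a collection of countable elementary submodels of `𝒦`, `T` is a collection of transitive
`W ≺ 𝒦` with `W ∈ K`, and the pair `(S, T)` is appropriate. -/
structure IsAppropriate (L : FirstOrder.Language.{v, w}) (K : ZFSet.{u}) [L.Structure (Carrier K)]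
    (S T : Set ZFSet.{u}) : Prop where
  small_countable : ∀ M ∈ S, (M : Set ZFSet.{u}).Countable
  small_elem : ∀ M ∈ S, IsElem L K M
  trans_transitive : ∀ W ∈ T, W.IsTransitive
  trans_elem : ∀ W ∈ T, IsElem L K W
  trans_mem : ∀ W ∈ T, W ∈ K
  inter_mem : ∀ M ∈ S, ∀ W ∈ T, M ∩ W ∈ S ∧ M ∩ W ∈ W

/-- The family `S*` (for `A = S`), respectively `T*` (for `A = T`), of those members of `A` that are
elementary in `𝒦*`. -/
def starFamily (L : FirstOrder.Language.{v, w}) (K : ZFSet.{u}) [L.Structure (Carrier K)]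
    (S T A : Set ZFSet.{u}) : Set ZFSet.{u} :=
  {M | M ∈ A ∧ IsElemStar L K S T M}

/-- The side condition poset: finite `∈`-chains `M₀ ∈ M₁ ∈ ⋯ ∈ Mₙ₋₁` of elements of `S ∪ T`
closed under intersection. -/
structure IsSideCondition (S T : Set ZFSet.{u}) (A : Finset ZFSet.{u}) : Prop where
  chain : ∃ l : List ZFSet.{u}, l.IsChain (· ∈ ·) ∧ ∀ M, M ∈ A ↔ M ∈ l
  node : ∀ M ∈ A, M ∈ S ∪ T
  inter : ∀ M ∈ A, ∀ N ∈ A, M ∩ N ∈ A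

/-- `N` is the successor of `M` in `A`, where nodes are ordered by their ranks. -/
def IsSuccNode (A : Finset ZFSet.{u}) (M N : ZFSet.{u}) : Prop :=
  M ∈ A ∧ N ∈ A ∧ M.rank < N.rank ∧ ∀ P ∈ A, ¬ (M.rank < P.rank ∧ P.rank < N.rank)

/-- The raw data of a decorated side condition: a finite set of nodes and a decoration. -/
structure DecPair where
  /-- the nodes `ℳ_p` -/
  nodes : Finset ZFSet.{u}
  /-- the decoration `d_p`, extended by `∅` outside `ℳ_p` in every condition -/
  deco : ZFSet.{u} → ZFSet.{u}

/-- The set of nodes as an element of the universe of sets. -/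
noncomputable def DecPair.nodeSet (p : DecPair.{u}) : ZFSet.{u} :=
  ZFSet.range (fun M : {M // M ∈ p.nodes} => M.1)

/-- The decoration as a function with domain the set of nodes, that is, as a set of pairs. -/
noncomputable def DecPair.decoSet (p : DecPair.{u}) : ZFSet.{u} :=
  ZFSet.range (fun M : {M // M ∈ p.nodes} => ZFSet.pair M.1 (p.deco M.1))

/-- The ordered pair `(ℳ_p, d_p)` as an element of the universe of sets. -/
noncomputable def DecPair.code (p : DecPair.{u}) : ZFSet.{u} :=
  ZFSet.pair p.nodeSet p.decoSet

/-- The decorated side condition poset. -/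
structure IsDecorated (K : ZFSet.{u}) (S T : Set ZFSet.{u}) (p : DecPair.{u}) : Prop where
  side : IsSideCondition S T p.nodes
  deco_off : ∀ M, M ∉ p.nodes → p.deco M = ∅
  deco_mem : ∀ M ∈ p.nodes, p.deco M ∈ K
  deco_finite : ∀ M ∈ p.nodes, (p.deco M : Set ZFSet.{u}).Finite
  deco_succ : ∀ M N, IsSuccNode p.nodes M N → p.deco M ∈ N

instance small_ordinals (x : ZFSet.{u}) : Small.{u} {o : Ordinal.{u} // o.toZFSet ∈ x} :=
  small_of_injective (β := {y : ZFSet.{u} // y ∈ x})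
    (f := fun o => ⟨o.1.toZFSet, o.2⟩)
    (fun _ _ h => Subtype.ext (Ordinal.toZFSet_injective (congrArg Subtype.val h)))

/-- The order type of `M ∩ θ`, where `θ` is the set of ordinals of `K`. -/
noncomputable def otp (K M : ZFSet.{u}) : Ordinal.{u} :=
  Ordinal.type (fun a b : Shrink.{u} {o : Ordinal.{u} // o.toZFSet ∈ M ∩ K} => a < b)

/-- The graph of the height function `h_A`: `h_A(α, ξ) = β`. Here `(α, ξ)` is in the domain of `h_A`
if and only if `α ∈ M` and `M ∩ ω₁ = ξ` for some small node `M`, and `β` is then the largest of the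
order types of `M ∩ θ` for such `M`. -/
def Height (K : ZFSet.{u}) (S : Set ZFSet.{u}) (A : Finset ZFSet.{u}) (α ξ β : Ordinal.{u}) :
    Prop :=
  IsGreatest {γ | ∃ M ∈ A, M ∈ S ∧ α.toZFSet ∈ M ∧ M ∩ omegaOne = ξ.toZFSet ∧ γ = otp K M} β

/-- The poset `𝕄*_{S,T}`. -/
structure IsCond (K : ZFSet.{u}) (S T : Set ZFSet.{u}) (p : DecPair.{u}) : Prop where
  decorated : IsDecorated K S T p
  height_mem : ∀ M ∈ p.nodes, M ∈ S → ∀ N ∈ p.nodes, N ∈ S →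
    N ∩ omegaOne ∈ M → (otp K N).toZFSet ∈ M

/-- The ordering `q ≤ p` of `𝕄*_{S,T}`. -/
structure Extends (K : ZFSet.{u}) (S : Set ZFSet.{u}) (q p : DecPair.{u}) : Prop where
  nodes_subset : p.nodes ⊆ q.nodes
  deco_subset : ∀ M ∈ p.nodes, p.deco M ⊆ q.deco M
  height_extends : ∀ α ξ β, Height K S p.nodes α ξ β → Height K S q.nodes α ξ β

/-- The condition `q` is a reflection of `p` inside `Q`. -/
structure IsReflection (K : ZFSet.{u}) (S T : Set ZFSet.{u}) (p : DecPair.{u}) (Q : ZFSet.{u})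
    (q : DecPair.{u}) : Prop where
  cond : IsCond K S T q
  code_mem : q.code ∈ Q
  nodes_subset : ∀ M ∈ p.nodes, M ∈ Q → M ∈ q.nodes
  deco_subset : ∀ R ∈ q.nodes, R ∈ Q → p.deco R ⊆ q.deco R
  height_extends : ∀ α ξ β, Height K S p.nodes α ξ β → ZFSet.pair α.toZFSet ξ.toZFSet ∈ Q →
    Height K S q.nodes α ξ β

/-- The closure of `A` under binary intersections. -/
inductive InterClosure (A : Set ZFSet.{u}) : ZFSet.{u} → Prop
  | base {M : ZFSet.{u}} : M ∈ A → InterClosure A M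
  | inter {M N : ZFSet.{u}} : InterClosure A M → InterClosure A N → InterClosure A (M ∩ N)

end TwoTypes

/-! The condition r has as nodes those of p and q together with all M ∩ W, where M is a small node
of p and W a transitive node of q. It keeps the decoration of q on nodes of q and that of p
elsewhere.

Shape of the chain. By `mem_or_le_or_gap`, a node of p outside Q has rank at least that of Q or lies
in a gap [Q ∩ W, W), with W ∈ Q transitive. Nodes of q lie in Q, hence avoid the gaps: below W they
are elements of Q ∩ W. By `exists_good`, an intersection M ∩ W that is in neither p nor q can be
written with M ⊇ Q ∩ W, so it sits between Q ∩ W and W and contains every node of q below W. Hence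
any two nodes are joined by a path of memberships, and a finite set with this property is an ∈-chain
when sorted by rank. Closure under intersection reduces to M ∩ N with M in p and N in q.

Heights. A small node of r that is not in q is contained in a small node of p with the same trace on
ω₁. It therefore raises no maximum, given that the heights of p and q agree on pairs in Q.

Order types. With δ(M) = M ∩ ω₁, the last clause says that δ(N) < δ(M) implies otp(N) < δ(M). Only
the mixed cases matter. For M in p and N in q, either δ(M) ∈ Q and M may be replaced by M ∩ Q, a
node of q, or δ(M) bounds Q ∩ ω₁, which contains otp(N). For M in q and N in p, the height function
provides a node of q with the same δ as N and at least its order type.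

What is used about models is that elementary submodels contain ω₁ and the order types of their
elements, are closed under definable operations, and include their countable elements
(`subset_of_countable`). -/

namespace TwoTypes

/-! ### Calculus of definable predicates over (K, ∈) -/

section Definability

variable {K : ZFSet.{u}} {A : Set (Carrier K)} {α : Type}

/-- The predicate `P` on assignments is definable over `(K, ∈)` with parameters from `A`. -/
def Dfn (A : Set (Carrier K)) (P : (α → Carrier K) → Prop) : Prop :=
  A.Definable setLang (Set.ofPred P)

/-- The function `t` on assignments is given by a term with parameters from `A`. -/
def IsTerm (A : Set (Carrier K)) (t : (α → Carrier K) → Carrier K) : Prop :=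
  ∃ τ : (setLang[[A]]).Term α, ∀ v, τ.realize v = t v

theorem IsTerm.var (i : α) : IsTerm A (fun v : α → Carrier K => v i) :=
  ⟨Language.Term.var i, fun _ => rfl⟩

theorem IsTerm.const {c : Carrier K} (hc : c ∈ A) : IsTerm A (fun _ : α → Carrier K => c) :=
  ⟨(setLang.con (⟨c, hc⟩ : A)).term, fun v => by simp⟩

theorem Dfn.congr {P Q : (α → Carrier K) → Prop} (h : Dfn A Q) (hPQ : ∀ v, P v ↔ Q v) :
    Dfn A P := by
  rwa [show P = Q from funext fun v => propext (hPQ v)]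

theorem Dfn.and {P Q : (α → Carrier K) → Prop} (hP : Dfn A P) (hQ : Dfn A Q) :
    Dfn A (fun v => P v ∧ Q v) := Set.Definable.inter hP hQ

theorem Dfn.or {P Q : (α → Carrier K) → Prop} (hP : Dfn A P) (hQ : Dfn A Q) :
    Dfn A (fun v => P v ∨ Q v) := Set.Definable.union hP hQ

theorem Dfn.not {P : (α → Carrier K) → Prop} (hP : Dfn A P) : Dfn A (fun v => ¬ P v) :=
  Set.Definable.compl hP

theorem Dfn.imp {P Q : (α → Carrier K) → Prop} (hP : Dfn A P) (hQ : Dfn A Q) :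
    Dfn A (fun v => P v → Q v) := (hP.not.or hQ).congr fun v => by tauto

theorem Dfn.iff {P Q : (α → Carrier K) → Prop} (hP : Dfn A P) (hQ : Dfn A Q) :
    Dfn A (fun v => P v ↔ Q v) := ((hP.imp hQ).and (hQ.imp hP)).congr fun v => by tauto

theorem Dfn.ex {P : (α → Carrier K) → Carrier K → Prop}
    (h : Dfn A (fun w : α ⊕ Unit → Carrier K => P (fun i => w (Sum.inl i)) (w (Sum.inr ())))) :
    Dfn A (fun v => ∃ x, P v x) := by
  refine Dfn.congr (Set.Definable.exists_of_finite h) fun v => ?_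
  exact ⟨fun ⟨x, hx⟩ => ⟨fun _ => x, hx⟩, fun ⟨x, hx⟩ => ⟨x (), hx⟩⟩

theorem Dfn.all {P : (α → Carrier K) → Carrier K → Prop}
    (h : Dfn A (fun w : α ⊕ Unit → Carrier K => P (fun i => w (Sum.inl i)) (w (Sum.inr ())))) :
    Dfn A (fun v => ∀ x, P v x) :=
  (Dfn.not (Dfn.ex (P := fun v x => ¬ P v x) h.not)).congr fun v => by simp

/-- This allows a notion to be shown definable once, in bare variables, and then used with
parameters from a submodel or under further quantifiers. -/
theorem Dfn.subst {β : Type} {P : (β → Carrier K) → Prop} (h : Dfn A P)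
    {t : β → (α → Carrier K) → Carrier K} (ht : ∀ i, IsTerm A (t i)) :
    Dfn A (fun v => P fun i => t i v) := by
  obtain ⟨φ, hφ⟩ := h
  choose τ hτ using ht
  refine ⟨φ.subst τ, ?_⟩
  ext v
  have : ∀ w, P w ↔ φ.Realize w := fun w => Set.ext_iff.1 hφ w
  simp only [Set.mem_ofPred_eq, this]
  unfold Language.Formula.Realize
  rw [Language.BoundedFormula.realize_subst]
  simp only [hτ]

theorem Dfn.subst₁ {P : Carrier K → Prop}
    (h : Dfn A (fun v : Fin 1 → Carrier K => P (v 0)))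
    {s : (α → Carrier K) → Carrier K} (hs : IsTerm A s) :
    Dfn A (fun v => P (s v)) :=
  Dfn.subst h (t := ![s]) (by intro i; fin_cases i; assumption)

theorem Dfn.subst₃ {P : Carrier K → Carrier K → Carrier K → Prop}
    (h : Dfn A (fun v : Fin 3 → Carrier K => P (v 0) (v 1) (v 2)))
    {s t r : (α → Carrier K) → Carrier K} (hs : IsTerm A s) (ht : IsTerm A t) (hr : IsTerm A r) :
    Dfn A (fun v => P (s v) (t v) (r v)) :=
  Dfn.subst h (t := ![s, t, r]) (by intro i; fin_cases i <;> assumption)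

theorem Dfn.mem {s t : (α → Carrier K) → Carrier K} (hs : IsTerm A s) (ht : IsTerm A t) :
    Dfn A (fun v => (s v).1 ∈ (t v).1) := by
  obtain ⟨σ, hσ⟩ := hs
  obtain ⟨τ, hτ⟩ := ht
  refine ⟨Language.Relations.formula₂
    ((setLang.lhomWithConstants A).onRelation (show setLang.Relations 2 from SetRel.mem)) σ τ, ?_⟩
  ext v
  refine Iff.symm (Language.Formula.realize_rel₂.trans ?_)
  rw [Language.LHom.map_onRelation, hσ, hτ]
  rfl

theorem Dfn.eq {s t : (α → Carrier K) → Carrier K} (hs : IsTerm A s) (ht : IsTerm A t) :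
    Dfn A (fun v => s v = t v) := by
  obtain ⟨σ, hσ⟩ := hs
  obtain ⟨τ, hτ⟩ := ht
  refine ⟨σ.equal τ, ?_⟩
  ext v
  rw [Set.mem_ofPred_eq, Set.mem_ofPred_eq, Language.Formula.realize_equal, hσ, hτ]

end Definability

/-! ### Elementarity through the Tarski–Vaught criterion -/

section Elementarity

/-- A set `N ⊆ K` which meets every nonempty set definable over `(K, ∈)` with parameters
from `N`. -/
def IsElemSub (K N : ZFSet.{u}) : Prop :=
  N ⊆ K ∧ setLang.MeetsDefinable {x : Carrier K | x.1 ∈ N}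

theorem IsElem.isElemSub {L : FirstOrder.Language.{v, w}} {K N : ZFSet.{u}}
    [L.Structure (Carrier K)] (h : IsElem L K N) : IsElemSub K N := by
  obtain ⟨hN, E, hE⟩ := h
  refine ⟨hN, fun D hD hDef => ?_⟩
  rw [← hE] at hDef ⊢
  exact E.meetsDefinable D hD
    (Set.Definable.map_expansion hDef (Language.LHom.sumInl : setLang →ᴸ modelLang L))

variable {K N : ZFSet.{u}}

theorem IsElemSub.exists_mem (hN : IsElemSub K N) {P : Carrier K → Prop}
    (hP : Dfn {x : Carrier K | x.1 ∈ N} (fun v : Fin 1 → Carrier K => P (v 0)))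
    (hex : ∃ x, P x) : ∃ x, P x ∧ x.1 ∈ N :=
  hN.2 (Set.ofPred P) hex hP

theorem IsElemSub.mem_of_unique (hN : IsElemSub K N) {P : Carrier K → Prop}
    (hP : Dfn {x : Carrier K | x.1 ∈ N} (fun v : Fin 1 → Carrier K => P (v 0)))
    {c : Carrier K} (hc : P c) (huniq : ∀ x, P x → x = c) : c.1 ∈ N := by
  obtain ⟨x, hx, hxN⟩ := hN.exists_mem hP ⟨c, hc⟩
  rwa [huniq x hx] at hxN

end Elementarity

/-! ### Injections and the collapse of a set of ordinals -/

/-- `f` relates every element of `a` to an element of `b`, and it is functional and injective. -/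
def InjRel (f a b : ZFSet.{u}) : Prop :=
  (∀ x ∈ a, ∃ y ∈ b, ZFSet.pair x y ∈ f) ∧
    (∀ x x' y, ZFSet.pair x y ∈ f → ZFSet.pair x' y ∈ f → x = x') ∧
    ∀ x y y', ZFSet.pair x y ∈ f → ZFSet.pair x y' ∈ f → y = y'

theorem InjIn.exists_injRel {K a b : ZFSet.{u}} (h : InjIn K a b) : ∃ f ∈ K, InjRel f a b := by
  obtain ⟨f, hf, ⟨hs, hfun⟩, hinj⟩ := h
  refine ⟨f, hf, fun x hx => ?_, hinj, fun x y y' h1 h2 => ?_⟩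
  · obtain ⟨y, hy, -⟩ := hfun x hx
    exact ⟨y, (ZFSet.pair_mem_prod.1 (hs hy)).2, hy⟩
  · obtain ⟨z, -, hz⟩ := hfun x (ZFSet.pair_mem_prod.1 (hs h1)).1
    exact (hz y h1).trans (hz y' h2).symm

theorem InjRel.countable {f a b : ZFSet.{u}} (h : InjRel f a b)
    (hb : (b : Set ZFSet.{u}).Countable) : (a : Set ZFSet.{u}).Countable := by
  choose! g hg hgf using h.1
  exact Set.MapsTo.countable_of_injOn (f := g) (fun x hx => hg x hx)
    (fun x hx y hy hxy => h.2.1 x y (g x) (hgf x hx) (by rw [hxy]; exact hgf y hy)) hb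

/-- The Mostowski collapse of `x` along the membership relation of `b`. -/
noncomputable def coll (b : ZFSet.{u}) (x : ZFSet.{u}) : ZFSet.{u} :=
  ZFSet.range (fun u : {u // u ∈ x ∩ b} => coll b u.1)
termination_by x
decreasing_by exact (ZFSet.mem_inter.1 u.2).1

theorem mem_coll {b x w : ZFSet.{u}} : w ∈ coll b x ↔ ∃ y ∈ x, y ∈ b ∧ w = coll b y := by
  rw [coll, ZFSet.mem_range]
  constructor
  · rintro ⟨⟨y, hy⟩, rfl⟩
    exact ⟨y, (ZFSet.mem_inter.1 hy).1, (ZFSet.mem_inter.1 hy).2, rfl⟩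
  · rintro ⟨y, hy, hb, rfl⟩
    exact ⟨⟨y, ZFSet.mem_inter.2 ⟨hy, hb⟩⟩, rfl⟩

/-- `g` is the graph of the collapse of `y` along `b`. -/
def IsAttempt (b g y : ZFSet.{u}) : Prop :=
  (∀ x ∈ y, x ∈ b → ∃ v, ZFSet.pair x v ∈ g) ∧
    ∀ x v, ZFSet.pair x v ∈ g → x ∈ y ∧ x ∈ b ∧
      ∀ w, w ∈ v ↔ ∃ x' ∈ x, x' ∈ b ∧ ZFSet.pair x' w ∈ g

/-- Transitivity of `y` keeps the elements of any x ∈ y within reach of `g`, so ∈-induction forces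
all values. This makes `CollVal` functional in its last argument, as replacement requires. -/
theorem IsAttempt.eq_coll {b g y : ZFSet.{u}} (hg : IsAttempt b g y) (hy : y.IsTransitive)
    (x : ZFSet.{u}) : ∀ v, ZFSet.pair x v ∈ g → v = coll b x := by
  induction x using ZFSet.inductionOn with
  | h x ih =>
    intro v hv
    obtain ⟨hxy, hxb, hw⟩ := hg.2 x v hv
    ext w
    rw [hw, mem_coll]
    refine exists_congr fun x' => and_congr_right fun hx' => and_congr_right fun hb => ?_
    refine ⟨ih x' hx' w, ?_⟩
    rintro rfl
    obtain ⟨v', hv'⟩ := hg.1 x' (hy x hxy hx') hb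
    rwa [← ih x' hx' v' hv']

/-- Some element of `K` witnesses that `z` is the collapse of `y` along `b`. -/
def CollVal (K b y z : ZFSet.{u}) : Prop :=
  ∃ g ∈ K, IsAttempt b g y ∧ ∀ w, w ∈ z ↔ ∃ x, ZFSet.pair x w ∈ g

theorem CollVal.eq_coll {K b y z : ZFSet.{u}} (h : CollVal K b y z) (hy : y.IsTransitive) :
    z = coll b y := by
  obtain ⟨g, -, hg, hz⟩ := h
  ext w
  rw [hz, mem_coll]
  constructor
  · rintro ⟨x, hx⟩
    exact ⟨x, (hg.2 x w hx).1, (hg.2 x w hx).2.1, hg.eq_coll hy x w hx⟩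
  · rintro ⟨x, hx, hb, rfl⟩
    obtain ⟨v, hv⟩ := hg.1 x hx hb
    exact ⟨x, by rwa [← hg.eq_coll hy x v hv]⟩

theorem coll_inj {b x y : ZFSet.{u}} (hb : ∀ z ∈ b, z.IsOrdinal) (hx : x ∈ b) (hy : y ∈ b)
    (h : coll b x = coll b y) : x = y := by
  rcases (hb x hx).mem_trichotomous (hb y hy) with h' | h' | h'
  · exact absurd (mem_coll.2 ⟨x, h', hx, h.symm⟩ : coll b y ∈ coll b y) (ZFSet.mem_irrefl _)
  · exact h'
  · exact absurd (mem_coll.2 ⟨y, h', hy, h⟩ : coll b x ∈ coll b x) (ZFSet.mem_irrefl _)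

/-! ### Order types of sets of ordinals -/

section OrderType

theorem coll_eq_typein {K M b : ZFSet.{u}} (hb : ∀ x, x ∈ b ↔ x ∈ M ∩ K ∧ x.IsOrdinal)
    (o : Ordinal.{u}) : ∀ ho : o.toZFSet ∈ M ∩ K,
      coll b o.toZFSet = (Ordinal.typein (fun a b : Shrink.{u} {o : Ordinal.{u} //
        o.toZFSet ∈ M ∩ K} => a < b) (equivShrink _ ⟨o, ho⟩)).toZFSet := by
  induction o using WellFoundedLT.induction with
  | ind o ih =>
    intro ho
    ext w
    rw [mem_coll, Ordinal.mem_toZFSet_iff]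
    constructor
    · rintro ⟨y, hy, hyb, rfl⟩
      obtain ⟨a, hao, rfl⟩ := Ordinal.mem_toZFSet_iff.1 hy
      have ha := ((hb _).1 hyb).1
      refine ⟨_, ?_, (ih a hao ha).symm⟩
      rw [Ordinal.typein_lt_typein]
      simpa using hao
    · rintro ⟨c, hc, rfl⟩
      obtain ⟨s, rfl⟩ := Ordinal.typein_surj _ (hc.trans (Ordinal.typein_lt_type _ _))
      obtain ⟨⟨a, ha⟩, rfl⟩ := (equivShrink _).surjective s
      have hao : a < o := by
        rw [Ordinal.typein_lt_typein] at hc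
        simpa using hc
      exact ⟨a.toZFSet, Ordinal.toZFSet_mem_toZFSet_iff.2 hao,
        (hb _).2 ⟨ha, ZFSet.isOrdinal_toZFSet a⟩, (ih a hao ha).symm⟩

/-- The collapse sends each ordinal of M to its position. So `otp`, which is defined outside K,
becomes the range of a map that can be defined inside K. -/
theorem mem_otp {K M b : ZFSet.{u}} (hb : ∀ x, x ∈ b ↔ x ∈ M ∩ K ∧ x.IsOrdinal) (w : ZFSet.{u}) :
    w ∈ (otp K M).toZFSet ↔ ∃ x ∈ b, w = coll b x := by
  rw [Ordinal.mem_toZFSet_iff]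
  constructor
  · rintro ⟨c, hc, rfl⟩
    obtain ⟨s, rfl⟩ := Ordinal.typein_surj _ hc
    obtain ⟨⟨a, ha⟩, rfl⟩ := (equivShrink _).surjective s
    exact ⟨a.toZFSet, (hb _).2 ⟨ha, ZFSet.isOrdinal_toZFSet a⟩, (coll_eq_typein hb a ha).symm⟩
  · rintro ⟨x, hx, rfl⟩
    obtain ⟨hxM, hxo⟩ := (hb x).1 hx
    obtain ⟨a, rfl⟩ := ZFSet.isOrdinal_iff_mem_range_toZFSet.1 hxo
    exact ⟨_, Ordinal.typein_lt_type _ _, (coll_eq_typein hb a hxM).symm⟩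

theorem otp_mono {K M N : ZFSet.{u}} (h : M ⊆ N) : otp K M ≤ otp K N := by
  refine Ordinal.type_le_iff'.2 ⟨⟨⟨fun s => equivShrink _ ⟨((equivShrink _).symm s).1,
    ZFSet.mem_inter.2 ⟨h (ZFSet.mem_inter.1 ((equivShrink _).symm s).2).1,
      (ZFSet.mem_inter.1 ((equivShrink _).symm s).2).2⟩⟩, fun s t hst => ?_⟩, ?_⟩⟩
  · have h := (equivShrink {o : Ordinal.{u} // o.toZFSet ∈ N ∩ K}).injective hst
    exact (equivShrink _).symm.injective (Subtype.ext (Subtype.mk.inj h))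
  · intro s t
    obtain ⟨s, rfl⟩ := (equivShrink _).surjective s
    obtain ⟨t, rfl⟩ := (equivShrink _).surjective t
    change equivShrink _ _ < equivShrink _ _ ↔ _ < _
    simp

theorem otp_lt_omegaOne {K M : ZFSet.{u}} (h : (M : Set ZFSet.{u}).Countable) :
    otp K M < ω₁ := by
  have hc : Countable {o : Ordinal.{u} // o.toZFSet ∈ M ∩ K} := by
    have := h.to_subtype
    refine Function.Injective.countable (β := (M : Set ZFSet.{u}))
      (f := fun o => ⟨o.1.toZFSet, (ZFSet.mem_inter.1 o.2).1⟩) fun a b hab => ?_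
    exact Subtype.ext (Ordinal.toZFSet_injective (congrArg Subtype.val hab))
  rw [← Cardinal.ord_aleph, Cardinal.lt_ord, otp, Ordinal.card_type,
    ← Cardinal.succ_aleph0, Order.lt_succ_iff, Cardinal.mk_le_aleph0_iff]
  exact (equivShrink _).symm.injective.countable

theorem lt_omegaOne_iff_countable {o : Ordinal.{u}} :
    o < ω₁ ↔ (o.toZFSet : Set ZFSet.{u}).Countable := by
  rw [← Cardinal.ord_aleph, Cardinal.lt_ord, ← Cardinal.succ_aleph0, Order.lt_succ_iff,
    ← Ordinal.card_toZFSet, ← Cardinal.lift_le.{u + 1}, ← ZFSet.cardinalMk_coe_sort,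
    Cardinal.lift_aleph0]
  exact Cardinal.mk_le_aleph0_iff

end OrderType

/-! ### Absoluteness of the basic notions for the transitive model K -/

section Definability

variable {K : ZFSet.{u}} {A : Set (Carrier K)} {α : Type}

theorem IsTransitiveModel.mem_of_mem (hK : IsTransitiveModel K) {x y : ZFSet.{u}} (hx : x ∈ K)
    (hy : y ∈ x) : y ∈ K := hK.transitive x hx hy

theorem IsTransitiveModel.pair_mem (hK : IsTransitiveModel K) {x y : ZFSet.{u}} (hx : x ∈ K)
    (hy : y ∈ K) : ZFSet.pair x y ∈ K := by
  refine hK.pairing _ ?_ _ (hK.pairing _ hx _ hy)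
  rw [← ZFSet.pair_eq_singleton]
  exact hK.pairing _ hx _ hx

theorem IsTransitiveModel.fst_snd_mem (hK : IsTransitiveModel K) {x y : ZFSet.{u}}
    (h : ZFSet.pair x y ∈ K) : x ∈ K ∧ y ∈ K := by
  have h2 : ({x, y} : ZFSet.{u}) ∈ K := hK.mem_of_mem h (by simp [ZFSet.pair])
  exact ⟨hK.mem_of_mem h2 (by simp), hK.mem_of_mem h2 (by simp)⟩

theorem IsTransitiveModel.ext_iff (hK : IsTransitiveModel K) (x : Carrier K) (y : ZFSet.{u})
    (hy : y ⊆ K) : x.1 = y ↔ ∀ z : Carrier K, z.1 ∈ x.1 ↔ z.1 ∈ y := by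
  refine ⟨fun h z => by rw [h], fun h => ?_⟩
  ext z
  exact ⟨fun hz => (h ⟨z, hK.mem_of_mem x.2 hz⟩).1 hz, fun hz => (h ⟨z, hy hz⟩).2 hz⟩

theorem Dfn.upair (hK : IsTransitiveModel K) {r s t : (α → Carrier K) → Carrier K}
    (hr : IsTerm A r) (hs : IsTerm A s) (ht : IsTerm A t) :
    Dfn A (fun v => (r v).1 = {(s v).1, (t v).1}) := by
  have key : Dfn A (fun v : Fin 3 → Carrier K => (v 0).1 = {(v 1).1, (v 2).1}) := by
    have : Dfn A (fun v : Fin 3 → Carrier K => ∀ z, z.1 ∈ (v 0).1 ↔ z = v 1 ∨ z = v 2) := by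
      apply_rules (maxDepth := 1000) [Dfn.all, Dfn.iff, Dfn.or, Dfn.eq, Dfn.mem, IsTerm.var]
    refine this.congr fun v => ?_
    rw [hK.ext_iff _ _ (hK.transitive _ (hK.pairing _ (v 1).2 _ (v 2).2))]
    simp only [ZFSet.mem_pair, Subtype.ext_iff]
  exact Dfn.subst₃ (P := fun x y z => x.1 = {y.1, z.1}) key hr hs ht

theorem Dfn.pair (hK : IsTransitiveModel K) {r s t : (α → Carrier K) → Carrier K}
    (hr : IsTerm A r) (hs : IsTerm A s) (ht : IsTerm A t) :
    Dfn A (fun v => (r v).1 = ZFSet.pair (s v).1 (t v).1) := by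
  have key : Dfn A (fun v : Fin 3 → Carrier K => (v 0).1 = ZFSet.pair (v 1).1 (v 2).1) := by
    have : Dfn A (fun v : Fin 3 → Carrier K => ∃ a b : Carrier K, a.1 = {(v 1).1, (v 1).1} ∧
        b.1 = {(v 1).1, (v 2).1} ∧ (v 0).1 = {a.1, b.1}) := by
      apply_rules (maxDepth := 1000) [Dfn.ex, Dfn.and, Dfn.upair, IsTerm.var]
    refine this.congr fun v => ?_
    constructor
    · intro h
      refine ⟨⟨_, hK.pairing _ (v 1).2 _ (v 1).2⟩, ⟨_, hK.pairing _ (v 1).2 _ (v 2).2⟩, rfl, rfl, ?_⟩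
      simpa [ZFSet.pair] using h
    · rintro ⟨a, b, ha, hb, h⟩
      rw [h, ha, hb]
      simp [ZFSet.pair]
  exact Dfn.subst₃ (P := fun x y z => x.1 = ZFSet.pair y.1 z.1) key hr hs ht

theorem Dfn.pair_mem (hK : IsTransitiveModel K) {r s t : (α → Carrier K) → Carrier K}
    (hr : IsTerm A r) (hs : IsTerm A s) (ht : IsTerm A t) :
    Dfn A (fun v => ZFSet.pair (r v).1 (s v).1 ∈ (t v).1) := by
  have key : Dfn A (fun v : Fin 3 → Carrier K => ZFSet.pair (v 0).1 (v 1).1 ∈ (v 2).1) := by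
    have : Dfn A (fun v : Fin 3 → Carrier K => ∃ a : Carrier K, a.1 = ZFSet.pair (v 0).1 (v 1).1 ∧
        a.1 ∈ (v 2).1) := by
      apply_rules (maxDepth := 1000) [Dfn.ex, Dfn.and, Dfn.pair, Dfn.mem, IsTerm.var]
    refine this.congr fun v => ?_
    constructor
    · exact fun h => ⟨⟨_, hK.mem_of_mem (v 2).2 h⟩, rfl, h⟩
    · rintro ⟨a, ha, h⟩
      rwa [← ha]
  exact Dfn.subst₃ (P := fun x y z => ZFSet.pair x.1 y.1 ∈ z.1) key hr hs ht

/-- An ordinal is a transitive set of transitive sets; this is a bounded condition, hence absolute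
for K. -/
theorem Dfn.isOrdinal (hK : IsTransitiveModel K) {r : (α → Carrier K) → Carrier K}
    (hr : IsTerm A r) : Dfn A (fun v => (r v).1.IsOrdinal) := by
  have key : Dfn A (fun v : Fin 1 → Carrier K => (v 0).1.IsOrdinal) := by
    have : Dfn A (fun v : Fin 1 → Carrier K =>
        (∀ y z : Carrier K, y.1 ∈ (v 0).1 → z.1 ∈ y.1 → z.1 ∈ (v 0).1) ∧
        ∀ x y z : Carrier K, x.1 ∈ (v 0).1 → y.1 ∈ x.1 → z.1 ∈ y.1 → z.1 ∈ x.1) := by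
      apply_rules (maxDepth := 1000) [Dfn.and, Dfn.all, Dfn.imp, Dfn.mem, IsTerm.var]
    refine this.congr fun v => ?_
    rw [ZFSet.isOrdinal_iff_forall_mem_isTransitive]
    constructor
    · rintro ⟨h1, h2⟩
      exact ⟨fun y z hy hz => h1 _ hy hz, fun x y z hx hy hz => h2 _ hx _ hy hz⟩
    · rintro ⟨h1, h2⟩
      have h0 := fun {x} (hx : x ∈ (v 0).1) => hK.mem_of_mem (v 0).2 hx
      exact ⟨fun y hy z hz => h1 ⟨y, h0 hy⟩ ⟨z, hK.mem_of_mem (h0 hy) hz⟩ hy hz,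
        fun x hx y hy z hz => h2 ⟨x, h0 hx⟩ ⟨y, hK.mem_of_mem (h0 hx) hy⟩
          ⟨z, hK.mem_of_mem (hK.mem_of_mem (h0 hx) hy) hz⟩ hx hy hz⟩
  exact Dfn.subst₁ (P := fun x => x.1.IsOrdinal) key hr

theorem Dfn.injRel (hK : IsTransitiveModel K) {r s t : (α → Carrier K) → Carrier K}
    (hr : IsTerm A r) (hs : IsTerm A s) (ht : IsTerm A t) :
    Dfn A (fun v => InjRel (r v).1 (s v).1 (t v).1) := by
  have key : Dfn A (fun v : Fin 3 → Carrier K => InjRel (v 0).1 (v 1).1 (v 2).1) := by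
    have : Dfn A (fun v : Fin 3 → Carrier K =>
        (∀ x : Carrier K, x.1 ∈ (v 1).1 → ∃ y : Carrier K, y.1 ∈ (v 2).1 ∧
          ZFSet.pair x.1 y.1 ∈ (v 0).1) ∧
        (∀ x x' y : Carrier K, ZFSet.pair x.1 y.1 ∈ (v 0).1 → ZFSet.pair x'.1 y.1 ∈ (v 0).1 →
          x = x') ∧
        ∀ x y y' : Carrier K, ZFSet.pair x.1 y.1 ∈ (v 0).1 → ZFSet.pair x.1 y'.1 ∈ (v 0).1 →
          y = y') := by
      apply_rules (maxDepth := 1000) [Dfn.and, Dfn.all, Dfn.ex, Dfn.imp,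
        Dfn.mem, Dfn.pair_mem, Dfn.eq, IsTerm.var]
    refine this.congr fun v => ?_
    have h0 := fun {x y : ZFSet.{u}} (hx : ZFSet.pair x y ∈ (v 0).1) =>
      hK.fst_snd_mem (hK.mem_of_mem (v 0).2 hx)
    constructor
    · rintro ⟨h1, h2, h3⟩
      refine ⟨fun x hx => ?_, fun x x' y h h' => Subtype.ext (h2 _ _ _ h h'),
        fun x y y' h h' => Subtype.ext (h3 _ _ _ h h')⟩
      obtain ⟨y, hy, h⟩ := h1 x hx
      exact ⟨⟨y, (h0 h).2⟩, hy, h⟩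
    · rintro ⟨h1, h2, h3⟩
      refine ⟨fun x hx => ?_, fun x x' y h h' => ?_, fun x y y' h h' => ?_⟩
      · obtain ⟨y, hy, h⟩ := h1 ⟨x, hK.mem_of_mem (v 1).2 hx⟩ hx
        exact ⟨y, hy, h⟩
      · exact congrArg Subtype.val (h2 ⟨x, (h0 h).1⟩ ⟨x', (h0 h').1⟩ ⟨y, (h0 h).2⟩ h h')
      · exact congrArg Subtype.val (h3 ⟨x, (h0 h).1⟩ ⟨y, (h0 h).2⟩ ⟨y', (h0 h').2⟩ h h')
  exact Dfn.subst₃ (P := fun x y z => InjRel x.1 y.1 z.1) key hr hs ht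

theorem Dfn.isAttempt (hK : IsTransitiveModel K) {r s t : (α → Carrier K) → Carrier K}
    (hr : IsTerm A r) (hs : IsTerm A s) (ht : IsTerm A t) :
    Dfn A (fun v => IsAttempt (r v).1 (s v).1 (t v).1) := by
  have key : Dfn A (fun v : Fin 3 → Carrier K => IsAttempt (v 0).1 (v 1).1 (v 2).1) := by
    have : Dfn A (fun v : Fin 3 → Carrier K =>
        (∀ x : Carrier K, x.1 ∈ (v 2).1 → x.1 ∈ (v 0).1 → ∃ y : Carrier K,
          ZFSet.pair x.1 y.1 ∈ (v 1).1) ∧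
        ∀ x y : Carrier K, ZFSet.pair x.1 y.1 ∈ (v 1).1 → x.1 ∈ (v 2).1 ∧ x.1 ∈ (v 0).1 ∧
          ∀ w : Carrier K, w.1 ∈ y.1 ↔ ∃ x' : Carrier K, x'.1 ∈ x.1 ∧ x'.1 ∈ (v 0).1 ∧
            ZFSet.pair x'.1 w.1 ∈ (v 1).1) := by
      apply_rules (maxDepth := 1000) [Dfn.and, Dfn.all, Dfn.ex, Dfn.imp,
        Dfn.iff, Dfn.mem, Dfn.pair_mem, IsTerm.var]
    refine this.congr fun v => ?_
    have h0 := fun {x y : ZFSet.{u}} (hx : ZFSet.pair x y ∈ (v 1).1) =>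
      hK.fst_snd_mem (hK.mem_of_mem (v 1).2 hx)
    constructor
    · rintro ⟨h1, h2⟩
      refine ⟨fun x hx hx' => ?_, fun x y h => ⟨(h2 _ _ h).1, (h2 _ _ h).2.1, fun w => ?_⟩⟩
      · obtain ⟨y, hy⟩ := h1 x hx hx'
        exact ⟨⟨y, (h0 hy).2⟩, hy⟩
      · rw [(h2 _ _ h).2.2 w]
        exact ⟨fun ⟨x', h3, h4, h5⟩ => ⟨⟨x', (h0 h5).1⟩, h3, h4, h5⟩,
          fun ⟨x', h3⟩ => ⟨x', h3⟩⟩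
    · rintro ⟨h1, h2⟩
      refine ⟨fun x hx hx' => ?_, fun x y h => ?_⟩
      · obtain ⟨y, hy⟩ := h1 ⟨x, hK.mem_of_mem (v 2).2 hx⟩ hx hx'
        exact ⟨y, hy⟩
      · obtain ⟨h3, h4, h5⟩ := h2 ⟨x, (h0 h).1⟩ ⟨y, (h0 h).2⟩ h
        refine ⟨h3, h4, fun w => ⟨fun hw => ?_, fun ⟨x', h6, h7, h8⟩ => ?_⟩⟩
        · obtain ⟨x', hx'⟩ := (h5 ⟨w, hK.mem_of_mem (h0 h).2 hw⟩).1 hw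
          exact ⟨x', hx'⟩
        · exact (h5 ⟨w, (h0 h8).2⟩).2 ⟨⟨x', (h0 h8).1⟩, h6, h7, h8⟩
  exact Dfn.subst₃ (P := fun x y z => IsAttempt x.1 y.1 z.1) key hr hs ht

theorem Dfn.collVal (hK : IsTransitiveModel K) {r s t : (α → Carrier K) → Carrier K}
    (hr : IsTerm A r) (hs : IsTerm A s) (ht : IsTerm A t) :
    Dfn A (fun v => CollVal K (r v).1 (s v).1 (t v).1) := by
  have key : Dfn A (fun v : Fin 3 → Carrier K => CollVal K (v 0).1 (v 1).1 (v 2).1) := by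
    have : Dfn A (fun v : Fin 3 → Carrier K => ∃ g : Carrier K,
        IsAttempt (v 0).1 g.1 (v 1).1 ∧ ∀ w : Carrier K, w.1 ∈ (v 2).1 ↔
          ∃ x : Carrier K, ZFSet.pair x.1 w.1 ∈ g.1) := by
      apply_rules (maxDepth := 1000) [Dfn.isAttempt, Dfn.and, Dfn.all, Dfn.ex, Dfn.iff,
        Dfn.mem, Dfn.pair_mem, IsTerm.var]
    refine this.congr fun v => ?_
    constructor
    · rintro ⟨g, hg, h1, h2⟩
      refine ⟨⟨g, hg⟩, h1, fun w => ?_⟩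
      rw [h2]
      exact ⟨fun ⟨x, hx⟩ => ⟨⟨x, (hK.fst_snd_mem (hK.mem_of_mem hg hx)).1⟩, hx⟩,
        fun ⟨x, hx⟩ => ⟨x, hx⟩⟩
    · rintro ⟨g, h1, h2⟩
      refine ⟨g.1, g.2, h1, fun w => ⟨fun hw => ?_, fun ⟨x, hx⟩ => ?_⟩⟩
      · obtain ⟨x, hx⟩ := (h2 ⟨w, hK.mem_of_mem (v 2).2 hw⟩).1 hw
        exact ⟨x, hx⟩
      · have h0 := hK.fst_snd_mem (hK.mem_of_mem g.2 hx)
        exact (h2 ⟨w, h0.2⟩).2 ⟨⟨x, h0.1⟩, hx⟩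
  exact Dfn.subst₃ (P := fun x y z => CollVal K x.1 y.1 z.1) key hr hs ht

theorem IsTransitiveModel.sep_mem (hK : IsTransitiveModel K) {P : Carrier K → Prop}
    (hP : Dfn Set.univ (fun v : Fin 1 → Carrier K => P (v 0))) {a : ZFSet.{u}} (ha : a ∈ K) :
    ∃ b : Carrier K, ∀ x : Carrier K, x.1 ∈ b.1 ↔ x.1 ∈ a ∧ P x := by
  obtain ⟨b, hb, h⟩ := hK.separation (Set.ofPred P) hP a ha
  exact ⟨⟨b, hb⟩, h⟩

theorem IsTransitiveModel.replacement_mem (hK : IsTransitiveModel K)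
    {P : Carrier K → Carrier K → Prop}
    (hP : Dfn Set.univ (fun v : Fin 2 → Carrier K => P (v 0) (v 1))) {a : ZFSet.{u}} (ha : a ∈ K)
    (h : ∀ x : Carrier K, x.1 ∈ a → ∃! y, P x y) :
    ∃ b : Carrier K, ∀ y : Carrier K, y.1 ∈ b.1 ↔ ∃ x : Carrier K, x.1 ∈ a ∧ P x y := by
  obtain ⟨b, hb, h⟩ := hK.replacement (Set.ofPred fun x => P x.1 x.2) hP a ha h
  exact ⟨⟨b, hb⟩, h⟩

end Definability

/-! ### The collapse exists in K -/

section Collapse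

variable {K b : ZFSet.{u}}

/-- Replacement along `CollVal`. With a = x ∩ b it is the inductive step at x of the recursion; with
a = b it yields the whole collapse and its range. -/
theorem IsTransitiveModel.exists_collapse_graph (hK : IsTransitiveModel K) (hb : b ∈ K)
    (hord : ∀ x ∈ b, x.IsOrdinal) {a : ZFSet.{u}} (ha : a ∈ K) (hab : a ⊆ b)
    (h : ∀ y ∈ a, coll b y ∈ K ∧ CollVal K b y (coll b y)) :
    (∃ g ∈ K, ∀ p, p ∈ g ↔ ∃ y ∈ a, p = ZFSet.pair y (coll b y)) ∧
      ∃ z ∈ K, ∀ w, w ∈ z ↔ ∃ y ∈ a, w = coll b y := by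
  have htr : ∀ y ∈ a, y.IsTransitive := fun y hy => (hord y (hab hy)).isTransitive
  have haK := fun {y} (hy : y ∈ a) => hK.mem_of_mem ha hy
  constructor
  · obtain ⟨g, hg⟩ := hK.replacement_mem
      (P := fun y p => ∃ z : Carrier K, CollVal K b y.1 z.1 ∧ p.1 = ZFSet.pair y.1 z.1)
      (by
        have hc : IsTerm (Set.univ) (fun _ : Fin 2 ⊕ Unit → Carrier K => (⟨b, hb⟩ : Carrier K)) :=
          IsTerm.const (Set.mem_univ _)
        exact Dfn.ex (Dfn.and (Dfn.collVal hK hc (IsTerm.var _) (IsTerm.var _))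
          (Dfn.pair hK (IsTerm.var _) (IsTerm.var _) (IsTerm.var _)))) ha (by
        intro y hy
        refine ⟨⟨_, hK.pair_mem y.2 (h y hy).1⟩, ⟨⟨_, (h y hy).1⟩, (h y hy).2, rfl⟩, ?_⟩
        rintro p ⟨z, hz, hp⟩
        rw [hz.eq_coll (htr y hy)] at hp
        exact Subtype.ext hp)
    refine ⟨g.1, g.2, fun p => ⟨fun hp => ?_, ?_⟩⟩
    · obtain ⟨y, hy, z, hz, rfl⟩ := (hg ⟨p, hK.mem_of_mem g.2 hp⟩).1 hp
      exact ⟨y, hy, by rw [hz.eq_coll (htr y hy)]⟩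
    · rintro ⟨y, hy, rfl⟩
      exact (hg ⟨_, hK.pair_mem (haK hy) (h y hy).1⟩).2
        ⟨⟨y, haK hy⟩, hy, ⟨_, (h y hy).1⟩, (h y hy).2, rfl⟩
  · obtain ⟨z, hz⟩ := hK.replacement_mem (P := fun y w => CollVal K b y.1 w.1)
      (Dfn.collVal hK (IsTerm.const (c := ⟨b, hb⟩) (Set.mem_univ _)) (IsTerm.var _) (IsTerm.var _))
      ha (fun y hy => ⟨⟨_, (h y hy).1⟩, (h y hy).2, fun w hw =>
        Subtype.ext (hw.eq_coll (htr y hy))⟩)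
    refine ⟨z.1, z.2, fun w => ⟨fun hw => ?_, ?_⟩⟩
    · obtain ⟨y, hy, h'⟩ := (hz ⟨w, hK.mem_of_mem z.2 hw⟩).1 hw
      exact ⟨y, hy, h'.eq_coll (htr y hy)⟩
    · rintro ⟨y, hy, rfl⟩
      exact (hz ⟨_, (h y hy).1⟩).2 ⟨⟨y, haK hy⟩, hy, (h y hy).2⟩

/-- The ∈-recursion is carried out by induction outside K: once the values below x are in K,
replacement puts their graph on x ∩ b into K, and this graph is an attempt since the ordinal x is
transitive. -/
theorem IsTransitiveModel.collVal_coll (hK : IsTransitiveModel K) (hb : b ∈ K)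
    (hord : ∀ x ∈ b, x.IsOrdinal) (x : ZFSet.{u}) :
    x ∈ b → coll b x ∈ K ∧ CollVal K b x (coll b x) := by
  induction x using ZFSet.inductionOn with
  | h x ih =>
    intro hx
    have htr := (hord x hx).isTransitive
    obtain ⟨a, ha⟩ := hK.sep_mem (P := fun y => y.1 ∈ b)
      (Dfn.mem (IsTerm.var _) (IsTerm.const (c := ⟨b, hb⟩) (Set.mem_univ _)))
      (hK.mem_of_mem hb hx)
    have ha' : ∀ y, y ∈ a.1 ↔ y ∈ x ∧ y ∈ b := fun y =>
      ⟨fun hy => (ha ⟨y, hK.mem_of_mem a.2 hy⟩).1 hy,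
        fun hy => (ha ⟨y, hK.mem_of_mem hb hy.2⟩).2 hy⟩
    obtain ⟨⟨g, hg, hgp⟩, z, hz, hzw⟩ := hK.exists_collapse_graph hb hord a.2
      (fun y hy => ((ha' y).1 hy).2) (fun y hy => ih y ((ha' y).1 hy).1 ((ha' y).1 hy).2)
    have hpair : ∀ y v, ZFSet.pair y v ∈ g ↔ (y ∈ x ∧ y ∈ b) ∧ v = coll b y := by
      intro y v
      rw [hgp, ← ha']
      constructor
      · rintro ⟨y', hy', he⟩
        obtain ⟨rfl, rfl⟩ := ZFSet.pair_inj.1 he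
        exact ⟨hy', rfl⟩
      · rintro ⟨hy, rfl⟩
        exact ⟨y, hy, rfl⟩
    have hzc : z = coll b x := by
      ext w
      rw [hzw, mem_coll]
      exact exists_congr fun y => by rw [ha', and_assoc]
    refine ⟨hzc ▸ hz, g, hg, ⟨fun y hy hyb => ⟨_, (hpair y _).2 ⟨⟨hy, hyb⟩, rfl⟩⟩, ?_⟩, ?_⟩
    · intro y v hyv
      obtain ⟨⟨hy, hyb⟩, rfl⟩ := (hpair y v).1 hyv
      refine ⟨hy, hyb, fun w => ?_⟩
      rw [mem_coll]
      refine exists_congr fun y' => and_congr_right fun hy' => and_congr_right fun hb' => ?_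
      rw [hpair]
      exact ⟨fun h => ⟨⟨htr y hy hy', hb'⟩, h⟩, fun h => h.2⟩
    · intro w
      rw [mem_coll]
      exact exists_congr fun y => by rw [hpair, and_assoc]

theorem IsTransitiveModel.collVal_iff (hK : IsTransitiveModel K) (hb : b ∈ K)
    (hord : ∀ x ∈ b, x.IsOrdinal) {x : ZFSet.{u}} (hx : x ∈ b) (w : ZFSet.{u}) :
    CollVal K b x w ↔ w = coll b x := by
  refine ⟨fun h => h.eq_coll (hord x hx).isTransitive, ?_⟩
  rintro rfl
  exact (hK.collVal_coll hb hord x hx).2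

end Collapse

/-! ### Closure properties of elementary submodels -/

namespace IsElemSub

variable {K N : ZFSet.{u}}

theorem isTerm {α : Type} {x : ZFSet.{u}} (hx : x ∈ N) (hxK : x ∈ K) :
    IsTerm {x : Carrier K | x.1 ∈ N} (fun _ : α → Carrier K => (⟨x, hxK⟩ : Carrier K)) :=
  IsTerm.const hx

theorem mem_K (hN : IsElemSub K N) {x : ZFSet.{u}} (hx : x ∈ N) : x ∈ K := hN.1 hx

theorem empty_mem (hN : IsElemSub K N) (hK : IsTransitiveModel K) : (∅ : ZFSet.{u}) ∈ N := by
  have h0 : (∅ : ZFSet.{u}) ∈ K := hK.mem_of_mem hK.infinity (by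
    rw [← Ordinal.toZFSet_zero, Ordinal.toZFSet_mem_toZFSet_iff]
    exact Ordinal.omega0_pos)
  refine hN.mem_of_unique (P := fun x => ∀ y : Carrier K, y.1 ∉ x.1) (c := ⟨∅, h0⟩)
    (Dfn.all (Dfn.not (Dfn.mem (IsTerm.var _) (IsTerm.var _)))) (fun y => ZFSet.notMem_empty _) ?_
  intro x hx
  refine Subtype.ext ((ZFSet.eq_empty _).2 fun y hy => hx ⟨y, hK.mem_of_mem x.2 hy⟩ hy)

theorem pair_mem (hN : IsElemSub K N) (hK : IsTransitiveModel K) {x y : ZFSet.{u}} (hx : x ∈ N)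
    (hy : y ∈ N) : ZFSet.pair x y ∈ N := by
  have hx' := hN.mem_K hx
  have hy' := hN.mem_K hy
  exact hN.mem_of_unique (P := fun p => p.1 = ZFSet.pair x y) (c := ⟨_, hK.pair_mem hx' hy'⟩)
    (Dfn.pair hK (IsTerm.var _) (isTerm hx hx') (isTerm hy hy')) rfl fun p hp => Subtype.ext hp

theorem fst_snd_mem (hN : IsElemSub K N) (hK : IsTransitiveModel K) {x y : ZFSet.{u}}
    (h : ZFSet.pair x y ∈ N) : x ∈ N ∧ y ∈ N := by
  have hp := hN.mem_K h
  obtain ⟨hx, hy⟩ := hK.fst_snd_mem hp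
  constructor
  · refine hN.mem_of_unique (P := fun a => ∃ b : Carrier K, ZFSet.pair x y = ZFSet.pair a.1 b.1)
      (c := ⟨x, hx⟩) (Dfn.ex ?_) ⟨⟨y, hy⟩, rfl⟩ ?_
    · exact Dfn.pair hK (r := fun _ => ⟨_, hp⟩) (isTerm h hp) (IsTerm.var _) (IsTerm.var _)
    · rintro a ⟨b, hab⟩
      exact Subtype.ext (ZFSet.pair_inj.1 hab).1.symm
  · refine hN.mem_of_unique (P := fun b => ∃ a : Carrier K, ZFSet.pair x y = ZFSet.pair a.1 b.1)
      (c := ⟨y, hy⟩) (Dfn.ex ?_) ⟨⟨x, hx⟩, rfl⟩ ?_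
    · exact Dfn.pair hK (r := fun _ => ⟨_, hp⟩) (isTerm h hp) (IsTerm.var _) (IsTerm.var _)
    · rintro a ⟨b, hab⟩
      exact Subtype.ext (ZFSet.pair_inj.1 hab).2.symm

/-- A subset of an element of `N` that is definable with parameters from `N` is an element
of `N`. -/
theorem sep_mem (hN : IsElemSub K N) (hK : IsTransitiveModel K) {P : Carrier K → Prop}
    (hP : Dfn {x : Carrier K | x.1 ∈ N} (fun v : Fin 1 → Carrier K => P (v 0)))
    {a : ZFSet.{u}} (ha : a ∈ N) :
    ∃ b ∈ N, ∀ x : Carrier K, x.1 ∈ b ↔ x.1 ∈ a ∧ P x := by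
  have ha' := hN.mem_K ha
  obtain ⟨b, hb⟩ := hK.sep_mem (Set.Definable.mono hP (Set.subset_univ _)) ha'
  refine ⟨b.1, hN.mem_of_unique (P := fun b => ∀ x : Carrier K, x.1 ∈ b.1 ↔ x.1 ∈ a ∧ P x) ?_
    hb ?_, hb⟩
  · exact Dfn.all (Dfn.iff (Dfn.mem (IsTerm.var _) (IsTerm.var _))
      (Dfn.and (Dfn.mem (IsTerm.var _) (isTerm ha ha')) (Dfn.subst₁ hP (IsTerm.var _))))
  · intro c hc
    refine Subtype.ext ((hK.ext_iff c b.1 (hK.transitive _ b.2)).2 fun z => ?_)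
    rw [hc, hb]

theorem inter_mem (hN : IsElemSub K N) (hK : IsTransitiveModel K) {x y : ZFSet.{u}} (hx : x ∈ N)
    (hy : y ∈ N) : x ∩ y ∈ N := by
  have hy' := hN.mem_K hy
  obtain ⟨b, hb, h⟩ := hN.sep_mem hK (P := fun z => z.1 ∈ y)
    (Dfn.mem (IsTerm.var _) (isTerm hy hy')) hx
  convert hb
  ext z
  rw [ZFSet.mem_inter]
  exact ⟨fun hz => (h ⟨z, hK.mem_of_mem hy' hz.2⟩).2 hz,
    fun hz => (h ⟨z, hK.mem_of_mem (hN.mem_K hb) hz⟩).1 hz⟩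

theorem insert_self_mem (hN : IsElemSub K N) (hK : IsTransitiveModel K) {x : ZFSet.{u}}
    (hx : x ∈ N) (h : insert x x ∈ K) : insert x x ∈ N := by
  have hx' := hN.mem_K hx
  refine hN.mem_of_unique (P := fun y => ∀ z : Carrier K, z.1 ∈ y.1 ↔ z = ⟨x, hx'⟩ ∨ z.1 ∈ x)
    (c := ⟨_, h⟩) ?_ ?_ ?_
  · exact Dfn.all (Dfn.iff (Dfn.mem (IsTerm.var _) (IsTerm.var _))
      (Dfn.or (Dfn.eq (IsTerm.var _) (isTerm hx hx')) (Dfn.mem (IsTerm.var _) (isTerm hx hx'))))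
  · intro z
    rw [ZFSet.mem_insert_iff, Subtype.ext_iff]
  · intro y hy
    refine Subtype.ext ((hK.ext_iff y _ (hK.transitive _ h)).2 fun z => ?_)
    rw [hy, ZFSet.mem_insert_iff, Subtype.ext_iff]

theorem toZFSet_natCast_mem (hN : IsElemSub K N) (hK : IsTransitiveModel K) (n : ℕ) :
    (n : Ordinal.{u}).toZFSet ∈ N := by
  induction n with
  | zero => simpa using hN.empty_mem hK
  | succ n ih =>
    rw [Nat.cast_succ, Ordinal.toZFSet_add_one]
    refine hN.insert_self_mem hK ih (hK.mem_of_mem hK.infinity ?_)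
    rw [← Ordinal.toZFSet_add_one, Ordinal.toZFSet_mem_toZFSet_iff, ← Nat.cast_succ]
    exact Ordinal.natCast_lt_omega0 _

theorem omega_subset (hN : IsElemSub K N) (hK : IsTransitiveModel K) :
    (ω : Ordinal.{u}).toZFSet ⊆ N := by
  intro x hx
  obtain ⟨a, ha, rfl⟩ := Ordinal.mem_toZFSet_iff.1 hx
  obtain ⟨n, rfl⟩ := Ordinal.lt_omega0.1 ha
  exact hN.toZFSet_natCast_mem hK n

theorem omega_mem (hN : IsElemSub K N) (hK : IsTransitiveModel K) :
    (ω : Ordinal.{u}).toZFSet ∈ N := by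
  -- The definition of ω over (K, ∈): the least ordinal that is nonempty and has no largest element.
  let lim : Carrier K → Prop := fun x => (∃ y : Carrier K, y.1 ∈ x.1) ∧
    ∀ y : Carrier K, y.1 ∈ x.1 → ∃ z : Carrier K, z.1 ∈ x.1 ∧ y.1 ∈ z.1
  have hlim : Dfn {x : Carrier K | x.1 ∈ N} (fun v : Fin 1 → Carrier K => lim (v 0)) := by
    apply_rules (maxDepth := 1000) [Dfn.and, Dfn.all, Dfn.ex, Dfn.imp, Dfn.mem, IsTerm.var]
  have limOmega : lim ⟨_, hK.infinity⟩ := by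
    refine ⟨⟨⟨∅, hN.mem_K (hN.empty_mem hK)⟩, ?_⟩, fun y hy => ?_⟩
    · change ∅ ∈ (ω : Ordinal.{u}).toZFSet
      rw [← Ordinal.toZFSet_zero, Ordinal.toZFSet_mem_toZFSet_iff]
      exact Ordinal.omega0_pos
    · obtain ⟨a, ha, hay⟩ := Ordinal.mem_toZFSet_iff.1 hy
      have h1 : (a + 1).toZFSet ∈ (ω : Ordinal.{u}).toZFSet :=
        Ordinal.toZFSet_mem_toZFSet_iff.2 (Ordinal.isSuccLimit_omega0.add_one_lt ha)
      refine ⟨⟨_, hK.mem_of_mem hK.infinity h1⟩, h1, ?_⟩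
      rw [← hay, Ordinal.toZFSet_mem_toZFSet_iff]
      exact lt_add_one a
  have omega_le : ∀ x : Carrier K, lim x → ∀ o : Ordinal.{u}, o.toZFSet = x.1 → ω ≤ o := by
    rintro x ⟨⟨y, hy⟩, h⟩ o ho
    refine Ordinal.omega0_le.2 fun n => ?_
    suffices hn : (n : Ordinal.{u}) < o from hn.le
    induction n with
    | zero =>
      rw [← ho, Ordinal.mem_toZFSet_iff] at hy
      obtain ⟨a, ha, -⟩ := hy
      exact_mod_cast zero_le.trans_lt ha
    | succ n ih =>
      have hn : (n : Ordinal.{u}).toZFSet ∈ x.1 := ho ▸ Ordinal.toZFSet_mem_toZFSet_iff.2 ih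
      obtain ⟨z, hz, hnz⟩ := h ⟨_, hK.mem_of_mem x.2 hn⟩ hn
      rw [← ho, Ordinal.mem_toZFSet_iff] at hz
      obtain ⟨c, hc, hcz⟩ := hz
      have : (n : Ordinal.{u}).toZFSet ∈ z.1 := hnz
      rw [← hcz, Ordinal.toZFSet_mem_toZFSet_iff] at this
      rw [Nat.cast_succ]
      exact (Order.add_one_le_of_lt this).trans_lt hc
  refine hN.mem_of_unique (c := ⟨_, hK.infinity⟩)
    (P := fun x => x.1.IsOrdinal ∧ lim x ∧ ∀ y : Carrier K, y.1 ∈ x.1 → ¬ lim y) ?_ ?_ ?_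
  · exact Dfn.and (Dfn.isOrdinal hK (IsTerm.var _)) (Dfn.and hlim
      (Dfn.all (Dfn.imp (Dfn.mem (IsTerm.var _) (IsTerm.var _))
        (Dfn.not (Dfn.subst₁ hlim (IsTerm.var _))))))
  · refine ⟨ZFSet.isOrdinal_toZFSet _, limOmega, fun y hy hl => ?_⟩
    obtain ⟨a, ha, hay⟩ := Ordinal.mem_toZFSet_iff.1 hy
    exact (omega_le y hl a hay).not_gt ha
  · rintro x ⟨hx, hl, hmin⟩
    obtain ⟨o, ho⟩ := ZFSet.isOrdinal_iff_mem_range_toZFSet.1 hx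
    rcases (omega_le x hl o ho).eq_or_lt with h | h
    · exact Subtype.ext (by rw [← ho, ← h])
    · exact absurd limOmega (hmin _ (ho ▸ Ordinal.toZFSet_mem_toZFSet_iff.2 h))

/-- If an injective function `f ∈ N` takes a value in `N` at `x`, then `x ∈ N`. -/
theorem mem_of_pair_mem (hN : IsElemSub K N) (hK : IsTransitiveModel K) {f x y : ZFSet.{u}}
    (hf : f ∈ N) (hinj : ∀ x x' y, ZFSet.pair x y ∈ f → ZFSet.pair x' y ∈ f → x = x')
    (hxy : ZFSet.pair x y ∈ f) (hy : y ∈ N) : x ∈ N := by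
  have hf' := hN.mem_K hf
  have hy' := hN.mem_K hy
  exact hN.mem_of_unique (P := fun x => ZFSet.pair x.1 y ∈ f)
    (c := ⟨x, (hK.fst_snd_mem (hK.mem_of_mem hf' hxy)).1⟩)
    (Dfn.pair_mem hK (IsTerm.var _) (isTerm hy hy') (isTerm hf hf')) hxy
    fun x' h => Subtype.ext (hinj _ _ _ h hxy)

/-- Correctness of ω₁ puts an injection of the ordinal into ω in K, so by elementarity one is in N.
Since ω ⊆ N, preimages under it are in N. -/
theorem countable_ordinal_subset (hN : IsElemSub K N) (hK : IsTransitiveModel K)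
    (hω : CorrectOmegaOne K) {o : Ordinal.{u}} (ho : o < ω₁) (hoN : o.toZFSet ∈ N) :
    o.toZFSet ⊆ N := by
  have hoK := hN.mem_K hoN
  obtain ⟨f, hf, hfi⟩ := (hω.2 _ (Ordinal.toZFSet_mem_toZFSet_iff.2 ho)).exists_injRel
  obtain ⟨g, hg, hgN⟩ := hN.exists_mem (P := fun g => InjRel g.1 o.toZFSet (ω : Ordinal).toZFSet)
    (Dfn.injRel hK (IsTerm.var _) (isTerm hoN hoK) (isTerm (hN.omega_mem hK) hK.infinity))
    ⟨⟨f, hf⟩, hfi⟩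
  intro x hx
  obtain ⟨y, hy, hxy⟩ := hg.1 x hx
  exact hN.mem_of_pair_mem hK hgN hg.2.1 hxy (hN.omega_subset hK hy)

/-- By correctness, ω₁ is definable in K as the set of ordinals that K can inject into ω. -/
theorem omegaOne_mem (hN : IsElemSub K N) (hK : IsTransitiveModel K)
    (hω : CorrectOmegaOne K) : omegaOne ∈ N := by
  have key : ∀ x : Carrier K, x.1 ∈ omegaOne ↔ x.1.IsOrdinal ∧
      ∃ f : Carrier K, InjRel f.1 x.1 (ω : Ordinal).toZFSet := by
    intro x
    constructor
    · intro hx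
      obtain ⟨f, hf, hfi⟩ := (hω.2 _ hx).exists_injRel
      exact ⟨(ZFSet.isOrdinal_toZFSet _).mem hx, ⟨f, hf⟩, hfi⟩
    · rintro ⟨hx, f, hf⟩
      obtain ⟨o, ho⟩ := ZFSet.isOrdinal_iff_mem_range_toZFSet.1 hx
      rw [← ho, omegaOne, Ordinal.toZFSet_mem_toZFSet_iff, lt_omegaOne_iff_countable, ho]
      refine hf.countable ?_
      rw [← lt_omegaOne_iff_countable]
      exact Ordinal.omega0_lt_omega_one
  refine hN.mem_of_unique (c := ⟨_, hω.1⟩) (P := fun y => ∀ x : Carrier K, x.1 ∈ y.1 ↔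
    x.1.IsOrdinal ∧ ∃ f : Carrier K, InjRel f.1 x.1 (ω : Ordinal).toZFSet) ?_ key ?_
  · exact Dfn.all (Dfn.iff (Dfn.mem (IsTerm.var _) (IsTerm.var _)) (Dfn.and
      (Dfn.isOrdinal hK (IsTerm.var _)) (Dfn.ex (Dfn.injRel hK (IsTerm.var _) (IsTerm.var _)
        (isTerm (hN.omega_mem hK) hK.infinity)))))
  · intro y hy
    refine Subtype.ext ((hK.ext_iff y _ (hK.transitive _ hω.1)).2 fun z => ?_)
    rw [hy, key]

theorem ordinals_mem (hN : IsElemSub K N) (hK : IsTransitiveModel K) {a : ZFSet.{u}}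
    (ha : a ∈ N) : ∃ b ∈ N, ∀ x, x ∈ b ↔ x ∈ a ∩ K ∧ x.IsOrdinal := by
  have ha' := hN.mem_K ha
  obtain ⟨b, hb, h⟩ := hN.sep_mem hK (P := fun x => x.1.IsOrdinal)
    (Dfn.isOrdinal hK (IsTerm.var _)) ha
  refine ⟨b, hb, fun x => ⟨fun hx => ?_, fun hx => ?_⟩⟩
  · have hxK := hK.mem_of_mem (hN.mem_K hb) hx
    obtain ⟨h1, h2⟩ := (h ⟨x, hxK⟩).1 hx
    exact ⟨ZFSet.mem_inter.2 ⟨h1, hxK⟩, h2⟩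
  · obtain ⟨h1, h2⟩ := ZFSet.mem_inter.1 hx.1
    exact (h ⟨x, h2⟩).2 ⟨h1, hx.2⟩

theorem collapse_graph_mem (hN : IsElemSub K N) (hK : IsTransitiveModel K) {b : ZFSet.{u}}
    (hb : b ∈ N) (hord : ∀ x ∈ b, x.IsOrdinal) :
    ∃ g ∈ N, ∀ p, p ∈ g ↔ ∃ y ∈ b, p = ZFSet.pair y (coll b y) := by
  have hb' := hN.mem_K hb
  obtain ⟨⟨g, hg, hgp⟩, -⟩ := hK.exists_collapse_graph hb' hord hb' (fun _ h => h)
    (fun y hy => hK.collVal_coll hb' hord y hy)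
  have key : ∀ p : Carrier K, p.1 ∈ g ↔ ∃ y z : Carrier K, y.1 ∈ b ∧
      CollVal K b y.1 z.1 ∧ p.1 = ZFSet.pair y.1 z.1 := by
    intro p
    rw [hgp]
    constructor
    · rintro ⟨y, hy, hp⟩
      have h := hK.collVal_coll hb' hord y hy
      exact ⟨⟨y, hK.mem_of_mem hb' hy⟩, ⟨_, h.1⟩, hy, h.2, hp⟩
    · rintro ⟨y, z, hy, hz, hp⟩
      exact ⟨y, hy, by rw [hp, (hK.collVal_iff hb' hord hy _).1 hz]⟩
  refine ⟨g, hN.mem_of_unique (c := ⟨g, hg⟩) (P := fun g => ∀ p : Carrier K, p.1 ∈ g.1 ↔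
    ∃ y z : Carrier K, y.1 ∈ b ∧ CollVal K b y.1 z.1 ∧ p.1 = ZFSet.pair y.1 z.1) ?_ key ?_, hgp⟩
  · exact Dfn.all (Dfn.iff (Dfn.mem (IsTerm.var _) (IsTerm.var _)) (Dfn.ex (Dfn.ex (Dfn.and
      (Dfn.mem (IsTerm.var _) (isTerm hb hb')) (Dfn.and
        (Dfn.collVal hK (isTerm hb hb') (IsTerm.var _) (IsTerm.var _))
        (Dfn.pair hK (IsTerm.var _) (IsTerm.var _) (IsTerm.var _)))))))
  · intro g' h
    refine Subtype.ext ((hK.ext_iff g' g (hK.transitive _ hg)).2 fun z => ?_)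
    rw [h, key]

theorem toZFSet_otp_mem (hN : IsElemSub K N) (hK : IsTransitiveModel K) {a : ZFSet.{u}}
    (ha : a ∈ N) : (otp K a).toZFSet ∈ N := by
  obtain ⟨b, hb, hba⟩ := hN.ordinals_mem hK ha
  have hord : ∀ x ∈ b, x.IsOrdinal := fun x hx => ((hba x).1 hx).2
  have hb' := hN.mem_K hb
  obtain ⟨-, z, hz, hzw⟩ := hK.exists_collapse_graph hb' hord hb' (fun _ h => h)
    (fun y hy => hK.collVal_coll hb' hord y hy)
  have hzo : z = (otp K a).toZFSet := by
    ext w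
    rw [hzw, mem_otp hba]
  rw [← hzo]
  have key : ∀ w : Carrier K, w.1 ∈ z ↔ ∃ y : Carrier K, y.1 ∈ b ∧ CollVal K b y.1 w.1 := by
    intro w
    rw [hzw]
    constructor
    · rintro ⟨y, hy, hw⟩
      exact ⟨⟨y, hK.mem_of_mem hb' hy⟩, hy, (hK.collVal_iff hb' hord hy _).2 hw⟩
    · rintro ⟨y, hy, hw⟩
      exact ⟨y, hy, (hK.collVal_iff hb' hord hy _).1 hw⟩
  refine hN.mem_of_unique (c := ⟨z, hz⟩) (P := fun z => ∀ w : Carrier K, w.1 ∈ z.1 ↔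
    ∃ y : Carrier K, y.1 ∈ b ∧ CollVal K b y.1 w.1) ?_ key ?_
  · exact Dfn.all (Dfn.iff (Dfn.mem (IsTerm.var _) (IsTerm.var _)) (Dfn.ex (Dfn.and
      (Dfn.mem (IsTerm.var _) (isTerm hb hb'))
      (Dfn.collVal hK (isTerm hb hb') (IsTerm.var _) (IsTerm.var _)))))
  · intro z' h
    refine Subtype.ext ((hK.ext_iff z' z (hK.transitive _ hz)).2 fun w => ?_)
    rw [h, key]

/-- Countable elements of an elementary submodel are subsets of it. -/
theorem subset_of_countable (hN : IsElemSub K N) (hK : IsTransitiveModel K)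
    (hω : CorrectOmegaOne K) {a : ZFSet.{u}} (ha : a ∈ N) (hc : (a : Set ZFSet.{u}).Countable) :
    a ⊆ N := by
  have ha' := hN.mem_K ha
  -- Countability of a is not assumed to be witnessed in K. So a is first injected into an ordinal
  -- by some f ∈ N; the range b is a countable set of ordinals in N, whose order type is a countable
  -- ordinal in N and hence a subset of N. Pulling back along the collapse of b and then along f
  -- recovers the elements of a.
  obtain ⟨o₀, ho₀, hord₀, hinj₀⟩ := hK.choice a ha'
  obtain ⟨f₀, hf₀, hf₀i⟩ := hinj₀.exists_injRel
  obtain ⟨f, ⟨o', ho', hfo'⟩, hfN⟩ := hN.exists_mem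
    (P := fun f => ∃ o : Carrier K, o.1.IsOrdinal ∧ InjRel f.1 a o.1)
    (Dfn.ex (Dfn.and (Dfn.isOrdinal hK (IsTerm.var _))
      (Dfn.injRel hK (IsTerm.var _) (isTerm ha ha') (IsTerm.var _))))
    ⟨⟨f₀, hf₀⟩, ⟨o₀, ho₀⟩, hord₀, hf₀i⟩
  obtain ⟨o, ⟨ho, hfo⟩, hoN⟩ := hN.exists_mem
    (P := fun o => o.1.IsOrdinal ∧ InjRel f.1 a o.1)
    (Dfn.and (Dfn.isOrdinal hK (IsTerm.var _))
      (Dfn.injRel hK (isTerm hfN f.2) (isTerm ha ha') (IsTerm.var _))) ⟨o', ho', hfo'⟩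
  obtain ⟨b, hbN, hb⟩ := hN.sep_mem hK
    (P := fun y => ∃ x : Carrier K, x.1 ∈ a ∧ ZFSet.pair x.1 y.1 ∈ f.1)
    (Dfn.ex (Dfn.and (Dfn.mem (IsTerm.var _) (isTerm ha ha'))
      (Dfn.pair_mem hK (IsTerm.var _) (IsTerm.var _) (isTerm hfN f.2)))) hoN
  have hbK := hN.mem_K hbN
  have hb' : ∀ y ∈ b, y ∈ o.1 ∧ ∃ x ∈ a, ZFSet.pair x y ∈ f.1 := by
    intro y hy
    obtain ⟨h1, x, h2⟩ := (hb ⟨y, hK.mem_of_mem hbK hy⟩).1 hy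
    exact ⟨h1, x, h2⟩
  have hbord : ∀ y ∈ b, y.IsOrdinal := fun y hy => ho.mem (hb' y hy).1
  have hbc : (b : Set ZFSet.{u}).Countable := by
    choose! g hg hgf using fun y hy => (hb' y hy).2
    exact Set.MapsTo.countable_of_injOn (f := g) (fun y hy => hg y hy)
      (fun y hy z hz hyz => hfo.2.2 (g y) y z (hgf y hy) (by rw [hyz]; exact hgf z hz)) hc
  have hbb : ∀ x, x ∈ b ↔ x ∈ b ∩ K ∧ x.IsOrdinal := fun x =>
    ⟨fun hx => ⟨ZFSet.mem_inter.2 ⟨hx, hK.mem_of_mem hbK hx⟩, hbord x hx⟩,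
      fun hx => (ZFSet.mem_inter.1 hx.1).1⟩
  have hsub := hN.countable_ordinal_subset hK hω (otp_lt_omegaOne (K := K) hbc)
    (hN.toZFSet_otp_mem hK hbN)
  obtain ⟨g, hgN, hg⟩ := hN.collapse_graph_mem hK hbN hbord
  have hgp : ∀ y z, ZFSet.pair y z ∈ g ↔ y ∈ b ∧ z = coll b y := by
    intro y z
    rw [hg]
    constructor
    · rintro ⟨y', hy', h⟩
      obtain ⟨rfl, rfl⟩ := ZFSet.pair_inj.1 h
      exact ⟨hy', rfl⟩
    · rintro ⟨hy, rfl⟩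
      exact ⟨y, hy, rfl⟩
  intro x hx
  obtain ⟨y, hy, hxy⟩ := hfo.1 x hx
  have hyb : y ∈ b := (hb ⟨y, hK.mem_of_mem o.2 hy⟩).2 ⟨hy, ⟨x, hK.mem_of_mem ha' hx⟩, hx, hxy⟩
  refine hN.mem_of_pair_mem hK hfN hfo.2.1 hxy (hN.mem_of_pair_mem hK hgN ?_
    ((hgp y _).2 ⟨hyb, rfl⟩) (hsub ((mem_otp hbb _).2 ⟨y, hyb, rfl⟩)))
  intro y y' z h h'
  obtain ⟨hyb, rfl⟩ := (hgp _ _).1 h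
  obtain ⟨hyb', h⟩ := (hgp _ _).1 h'
  exact coll_inj hbord hyb hyb' h

end IsElemSub

/-! ### Membership paths and ∈-chains -/

/-- The properties of the families of small and transitive models on which the combinatorics of
side conditions depends. -/
structure ModelFamily (S T : Set ZFSet.{u}) : Prop where
  small_subset : ∀ M ∈ S, ∀ N ∈ S ∪ T, M ∈ N → M ⊆ N
  trans : ∀ W ∈ T, W.IsTransitive
  inter : ∀ M ∈ S, ∀ W ∈ T, M ∩ W ∈ S ∧ M ∩ W ∈ W
  inter_closed : ∀ N ∈ S ∪ T, ∀ M ∈ N, ∀ W ∈ N, M ∩ W ∈ N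

/-- `M` is connected to `N` by a path of memberships between elements of `A`. -/
def Below (A : Finset ZFSet.{u}) : ZFSet.{u} → ZFSet.{u} → Prop :=
  Relation.TransGen fun M N => M ∈ A ∧ N ∈ A ∧ M ∈ N

section Below

variable {A C : Finset ZFSet.{u}} {M N P : ZFSet.{u}}

theorem Below.of_mem (hM : M ∈ A) (hN : N ∈ A) (h : M ∈ N) : Below A M N :=
  Relation.TransGen.single ⟨hM, hN, h⟩

theorem Below.trans (h : Below A M N) (h' : Below A N P) : Below A M P :=
  Relation.TransGen.trans h h'

theorem Below.mono (hAC : A ⊆ C) (h : Below A M N) : Below C M N :=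
  Relation.TransGen.mono (fun _ _ h => ⟨hAC h.1, hAC h.2.1, h.2.2⟩) _ _ h

theorem Below.rank_lt (h : Below A M N) : M.rank < N.rank := by
  induction h with
  | single h => exact ZFSet.rank_lt_of_mem h.2.2
  | tail _ h ih => exact ih.trans (ZFSet.rank_lt_of_mem h.2.2)

/-- Induction by removing the node of least rank. The clause on the head of the list strengthens the
induction: it makes the removed node and the head of the remaining list consecutive. -/
theorem exists_chain_of_consecutive (A : Finset ZFSet.{u})
    (hinj : ∀ M ∈ A, ∀ N ∈ A, M.rank = N.rank → M = N)
    (hsucc : ∀ M N, IsSuccNode A M N → M ∈ N) :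
    ∃ l : List ZFSet.{u}, l.IsChain (· ∈ ·) ∧ (∀ M, M ∈ A ↔ M ∈ l) ∧
      ∀ M ∈ l.head?, ∀ N ∈ A, M.rank ≤ N.rank := by
  classical
  induction A using Finset.strongInduction with
  | H A ih =>
    rcases A.eq_empty_or_nonempty with rfl | hne
    · exact ⟨[], by simp⟩
    · obtain ⟨M, hM, hmin⟩ := A.exists_min_image ZFSet.rank hne
      obtain ⟨l, hl, hlA, hhead⟩ := ih (A.erase M) (Finset.erase_ssubset hM)
        (fun P hP N hN => hinj P (Finset.mem_of_mem_erase hP) N (Finset.mem_of_mem_erase hN))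
        (by
          rintro P N ⟨hP, hN, hlt, hbt⟩
          refine hsucc P N ⟨Finset.mem_of_mem_erase hP, Finset.mem_of_mem_erase hN, hlt, ?_⟩
          rintro R hR ⟨h1, h2⟩
          refine hbt R (Finset.mem_erase.2 ⟨?_, hR⟩) ⟨h1, h2⟩
          rintro rfl
          exact (hmin P (Finset.mem_of_mem_erase hP)).not_gt h1)
      refine ⟨M :: l, List.isChain_cons.2 ⟨fun y hy => ?_, hl⟩, fun N => ?_, ?_⟩
      · have hyA := (hlA y).2 (List.mem_of_mem_head? hy)
        have hyA' := Finset.mem_of_mem_erase hyA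
        refine hsucc M y ⟨hM, hyA', lt_of_le_of_ne (hmin y hyA') fun h =>
          Finset.ne_of_mem_erase hyA (hinj M hM y hyA' h).symm, ?_⟩
        rintro R hR ⟨h1, h2⟩
        refine (hhead y hy R (Finset.mem_erase.2 ⟨?_, hR⟩)).not_gt h2
        rintro rfl
        exact h1.false
      · rw [List.mem_cons, ← hlA, Finset.mem_erase]
        by_cases h : N = M
        · simp [h, hM]
        · simp [h]
      · simpa using hmin

/-- A finite set of sets is an `∈`-chain if any two of its elements are connected by a path of
memberships. -/
theorem exists_chain_of_below
    (h : ∀ M ∈ A, ∀ N ∈ A, M = N ∨ Below A M N ∨ Below A N M) :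
    ∃ l : List ZFSet.{u}, l.IsChain (· ∈ ·) ∧ ∀ M, M ∈ A ↔ M ∈ l := by
  obtain ⟨l, hl, hlA, -⟩ := exists_chain_of_consecutive A (fun M hM N hN he => by
    rcases h M hM N hN with h | h | h
    · exact h
    · exact absurd h.rank_lt he.not_lt
    · exact absurd h.rank_lt he.not_gt) (by
    rintro M N ⟨hM, hN, hlt, hbt⟩
    have hb : Below A M N := by
      rcases h M hM N hN with rfl | h | h
      · exact absurd hlt (lt_irrefl _)
      · exact h
      · exact absurd h.rank_lt hlt.not_gt
    -- A path between nodes of consecutive rank has a single step, as an intermediate node would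
    -- have rank strictly in between.
    rcases Relation.TransGen.head'_iff.1 hb with ⟨P, hMP, hPN⟩
    rcases Relation.reflTransGen_iff_eq_or_transGen.1 hPN with rfl | hPN
    · exact hMP.2.2
    · exact absurd ⟨ZFSet.rank_lt_of_mem hMP.2.2, Below.rank_lt hPN⟩ (hbt P hMP.2.1))
  exact ⟨l, hl, hlA⟩

end Below

/-! ### Structure of a single side condition: residue gaps -/

namespace IsSideCondition

variable {S T : Set ZFSet.{u}} {A : Finset ZFSet.{u}} {M N Q : ZFSet.{u}}

theorem eq_or_below (hA : IsSideCondition S T A) (hM : M ∈ A) (hN : N ∈ A) :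
    M = N ∨ Below A M N ∨ Below A N M := by
  obtain ⟨l, hl, hlA⟩ := hA.chain
  have key : ∀ l : List ZFSet.{u}, l.IsChain (· ∈ ·) → (∀ M ∈ l, M ∈ A) →
      l.Pairwise (Below A) := by
    intro l hl hlA
    have : l.IsChain (Below A) := by
      induction l with
      | nil => simp
      | cons a l ih =>
        rw [List.isChain_cons] at hl ⊢
        exact ⟨fun y hy => Below.of_mem (hlA a (by simp))
          (hlA y (List.mem_cons_of_mem _ (List.mem_of_mem_head? hy))) (hl.1 y hy),
          ih hl.2 fun M hM => hlA M (List.mem_cons_of_mem _ hM)⟩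
    have : IsTrans ZFSet.{u} (Below A) := ⟨fun _ _ _ => Below.trans⟩
    exact List.IsChain.pairwise ‹_›
  have hp := key l hl fun M hM => (hlA M).2 hM
  have : Std.Symm fun M N => M = N ∨ Below A M N ∨ Below A N M := ⟨fun x y h => by tauto⟩
  exact List.Pairwise.forall_of_forall (R := fun M N => M = N ∨ Below A M N ∨ Below A N M)
    (fun x _ => Or.inl rfl) (hp.imp fun h => Or.inr (Or.inl h)) ((hlA M).1 hM) ((hlA N).1 hN)

theorem eq_of_rank_eq (hA : IsSideCondition S T A) (hM : M ∈ A) (hN : N ∈ A)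
    (h : M.rank = N.rank) : M = N := by
  rcases hA.eq_or_below hM hN with h' | h' | h'
  · exact h'
  · exact absurd h'.rank_lt h.not_lt
  · exact absurd h'.rank_lt h.not_gt

theorem below_of_rank_lt (hA : IsSideCondition S T A) (hM : M ∈ A) (hN : N ∈ A)
    (h : M.rank < N.rank) : Below A M N := by
  rcases hA.eq_or_below hM hN with rfl | h' | h'
  · exact absurd h (lt_irrefl _)
  · exact h'
  · exact absurd h'.rank_lt h.not_gt

theorem mem_trans_of_rank_lt (hA : IsSideCondition S T A) (hF : ModelFamily S T) (hM : M ∈ A)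
    (hN : N ∈ A) (hNT : N ∈ T) (h : M.rank < N.rank) : M ∈ N := by
  have hb := hA.below_of_rank_lt hM hN h
  clear h hM
  induction hb using Relation.TransGen.head_induction_on with
  | single h => exact h.2.2
  | head h _ ih => exact hF.trans N hNT _ ih h.2.2

/-- Two nodes of a side condition are related by membership unless they are separated by a
transitive node. -/
theorem mem_or_exists_trans (hA : IsSideCondition S T A) (hF : ModelFamily S T) (hM : M ∈ A)
    (hN : N ∈ A) (h : M.rank < N.rank) :
    M ∈ N ∨ ∃ U ∈ A, U ∈ T ∧ M ∈ U ∧ U.rank < N.rank := by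
  have hb := hA.below_of_rank_lt hM hN h
  clear h hN
  induction hb with
  | single h => exact Or.inl h.2.2
  | tail _ h ih =>
    rename_i P N _
    have hr := ZFSet.rank_lt_of_mem h.2.2
    -- If the last node P before N is small, then P ⊆ N and M ∈ P gives M ∈ N; if it is transitive,
    -- P itself separates.
    rcases ih with ih | ⟨U, hU, hUT, hMU, hlt⟩
    · rcases hA.node P h.1 with hP | hP
      · exact Or.inl (hF.small_subset P hP N (hA.node N h.2.1) h.2.2 ih)
      · exact Or.inr ⟨P, h.1, hP, ih, hr⟩
    · exact Or.inr ⟨U, hU, hUT, hMU, hlt.trans hr⟩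

/-- A node that does not belong to `Q` is above `Q` or in one of the residue gaps of `Q`. -/
theorem mem_or_le_or_gap (hA : IsSideCondition S T A) (hF : ModelFamily S T) (hM : M ∈ A)
    (hQ : Q ∈ A) : M ∈ Q ∨ Q.rank ≤ M.rank ∨
      ∃ W ∈ A, W ∈ T ∧ W ∈ Q ∧ Q ∈ S ∧ Q ∩ W ∈ A ∧ (Q ∩ W).rank ≤ M.rank ∧ M ∈ W := by
  classical
  induction h : Q.rank using WellFoundedLT.induction generalizing Q with
  | ind o ih =>
    subst h
    by_cases hMQ : M ∈ Q
    · exact Or.inl hMQ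
    rcases le_or_gt Q.rank M.rank with hle | hlt
    · exact Or.inr (Or.inl hle)
    refine Or.inr (Or.inr ?_)
    have hQT : Q ∉ T := fun hQT => hMQ (hA.mem_trans_of_rank_lt hF hM hQ hQT hlt)
    have hQS : Q ∈ S := (hA.node Q hQ).resolve_right hQT
    have hne : (A.filter fun U => U ∈ T ∧ M ∈ U ∧ U.rank < Q.rank).Nonempty := by
      obtain ⟨U, hU, h⟩ := (hA.mem_or_exists_trans hF hM hQ hlt).resolve_left hMQ
      exact ⟨U, Finset.mem_filter.2 ⟨hU, h⟩⟩
    -- Choosing U of maximal rank forces U ∈ Q. Then M is in the gap of U, or its rank is below that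
    -- of Q ∩ U and the induction applies to Q ∩ U, whose gaps are gaps of Q.
    obtain ⟨U, hU, hmax⟩ := Finset.exists_max_image _ ZFSet.rank hne
    obtain ⟨hUA, hUT, hMU, hUQ⟩ := Finset.mem_filter.1 hU
    have hUQ' : U ∈ Q := by
      rcases hA.mem_or_exists_trans hF hUA hQ hUQ with h | ⟨V, hV, hVT, hUV, hVQ⟩
      · exact h
      · exact absurd (ZFSet.rank_lt_of_mem hUV) (hmax V (Finset.mem_filter.2
          ⟨hV, hVT, hF.trans V hVT U hUV hMU, hVQ⟩)).not_gt
    have hQU := hA.inter Q hQ U hUA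
    rcases le_or_gt (Q ∩ U).rank M.rank with hle | hlt'
    · exact ⟨U, hUA, hUT, hUQ', hQS, hQU, hle, hMU⟩
    · have hr : (Q ∩ U).rank < Q.rank :=
        (ZFSet.rank_lt_of_mem (hF.inter Q hQS U hUT).2).trans hUQ
      rcases ih _ hr hQU rfl with h | h | ⟨W, hW, hWT, hWQ, -, hQW, hle, hMW⟩
      · exact absurd (ZFSet.mem_inter.1 h).1 hMQ
      · exact absurd hlt' h.not_gt
      · obtain ⟨hWQ, hWU⟩ := ZFSet.mem_inter.1 hWQ
        have he : Q ∩ U ∩ W = Q ∩ W := by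
          ext z
          simp only [ZFSet.mem_inter]
          exact ⟨fun h => ⟨h.1.1, h.2⟩, fun h => ⟨⟨h.1, hF.trans U hUT W hWU h.2⟩, h.2⟩⟩
        rw [he] at hQW hle
        exact ⟨W, hW, hWT, hWQ, hQS, hQW, hle, hMW⟩

/-- The trichotomy is applied to the node M ∩ Q itself: if it lies in the gap of W, it is a subset
of Q ∩ W of no smaller rank, so the two are equal. -/
theorem inter_mem_or_eq (hA : IsSideCondition S T A) (hF : ModelFamily S T) (hM : M ∈ A)
    (hQ : Q ∈ A) : M ∩ Q ∈ Q ∨ M ∩ Q = Q ∨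
      ∃ W ∈ A, W ∈ T ∧ W ∈ Q ∧ Q ∈ S ∧ M ∩ Q = Q ∩ W := by
  have hMQ := hA.inter M hM Q hQ
  have hsub : M ∩ Q ⊆ Q := fun z hz => (ZFSet.mem_inter.1 hz).2
  rcases hA.mem_or_le_or_gap hF hMQ hQ with h | h | ⟨W, hW, hWT, hWQ, hQS, hQW, hle, hMW⟩
  · exact Or.inl h
  · exact Or.inr (Or.inl (hA.eq_of_rank_eq hMQ hQ (le_antisymm (ZFSet.rank_mono hsub) h)))
  · refine Or.inr (Or.inr ⟨W, hW, hWT, hWQ, hQS, ?_⟩)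
    refine hA.eq_of_rank_eq hMQ hQW (le_antisymm (ZFSet.rank_mono fun z hz => ?_) hle)
    exact ZFSet.mem_inter.2 ⟨hsub hz, hF.trans W hWT _ hMW hz⟩

/-- Small nodes of a side condition containing `W` remain comparable after intersection
with `W`. -/
theorem inter_trans_comparable (hA : IsSideCondition S T A) (hF : ModelFamily S T)
    {W : ZFSet.{u}} (hW : W ∈ T) (o : Ordinal.{u}) :
    ∀ M ∈ A, M ∈ S → W ∈ M → M.rank ≤ o → ∀ N ∈ A, N ∈ S → W ∈ N → N.rank ≤ o →
      M ∩ W = N ∩ W ∨ M ∩ W ∈ N ∩ W ∨ N ∩ W ∈ M ∩ W := by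
  induction o using WellFoundedLT.induction with
  | ind o ih =>
    have key : ∀ M ∈ A, M ∈ S → W ∈ M → M.rank ≤ o → ∀ N ∈ A, N ∈ S → W ∈ N → N.rank ≤ o →
        M.rank < N.rank → M ∩ W = N ∩ W ∨ M ∩ W ∈ N ∩ W ∨ N ∩ W ∈ M ∩ W := by
      intro M hM hMS hWM hMo N hN hNS hWN hNo hlt
      rcases hA.mem_or_exists_trans hF hM hN hlt with h | ⟨U, hU, hUT, hMU, hUN⟩
      · exact Or.inr (Or.inl (ZFSet.mem_inter.2
          ⟨hF.inter_closed N (hA.node N hN) M h W hWN, (hF.inter M hMS W hW).2⟩))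
      · have hWU : W ∈ U := hF.trans U hUT M hMU hWM
        have he : N ∩ U ∩ W = N ∩ W := by
          ext z
          simp only [ZFSet.mem_inter]
          exact ⟨fun h => ⟨h.1.1, h.2⟩, fun h => ⟨⟨h.1, hF.trans U hUT W hWU h.2⟩, h.2⟩⟩
        -- Since W ∈ M ∈ U, the separating node U contains W, so N may be replaced by N ∩ U; both
        -- ranks are now bounded by that of U, which is below `o`.
        have h := ih U.rank (hUN.trans_le hNo) M hM hMS hWM (ZFSet.rank_lt_of_mem hMU).le
          (N ∩ U) (hA.inter N hN U hU) (hF.inter N hNS U hUT).1 (ZFSet.mem_inter.2 ⟨hWN, hWU⟩)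
          (ZFSet.rank_lt_of_mem (hF.inter N hNS U hUT).2).le
        rwa [he] at h
    intro M hM hMS hWM hMo N hN hNS hWN hNo
    rcases lt_trichotomy M.rank N.rank with h | h | h
    · exact key M hM hMS hWM hMo N hN hNS hWN hNo h
    · exact Or.inl (by rw [hA.eq_of_rank_eq hM hN h])
    · have := key N hN hNS hWN hNo M hM hMS hWM hMo h
      tauto

end IsSideCondition

/-! ### Amalgamation of the two side conditions -/

/-- The side condition `B ⊆ Q` contains all elements of the side condition `A` that belong to
the node `Q` of `A`. -/
structure Amalgamable (S T : Set ZFSet.{u}) (A B : Finset ZFSet.{u}) (Q : ZFSet.{u}) : Prop where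
  left : IsSideCondition S T A
  right : IsSideCondition S T B
  node_mem : Q ∈ A
  mem_node : ∀ N ∈ B, N ∈ Q
  mem_right : ∀ M ∈ A, M ∈ Q → M ∈ B

open Classical in
/-- The nodes of the amalgamation of `A` and `B`. -/
noncomputable def amalgam (S T : Set ZFSet.{u}) (A B : Finset ZFSet.{u}) : Finset ZFSet.{u} :=
  A ∪ B ∪ Finset.image₂ (· ∩ ·) (A.filter (· ∈ S)) (B.filter (· ∈ T))

/-- `X` is the intersection of a small node of `A` with the transitive node `W` of `B`, and it
is to be placed between `Q ∩ W` and `W`. -/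
structure IsNewNode (S T : Set ZFSet.{u}) (A B : Finset ZFSet.{u}) (Q X W : ZFSet.{u}) :
    Prop where
  exists_eq : ∃ M ∈ A, M ∈ S ∧ W ∈ M ∧ X = M ∩ W
  trans_mem : W ∈ B
  trans : W ∈ T
  subset : Q ∩ W ⊆ X
  notMem : W ∉ A

variable {S T : Set ZFSet.{u}} {A B : Finset ZFSet.{u}} {Q X Y M N W : ZFSet.{u}}

theorem mem_amalgam : X ∈ amalgam S T A B ↔
    X ∈ A ∨ X ∈ B ∨ ∃ M ∈ A, M ∈ S ∧ ∃ W ∈ B, W ∈ T ∧ X = M ∩ W := by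
  classical
  rw [amalgam, Finset.mem_union, Finset.mem_union, Finset.mem_image₂, or_assoc]
  refine or_congr_right (or_congr_right ?_)
  constructor
  · rintro ⟨M, hM, W, hW, rfl⟩
    rw [Finset.mem_filter] at hM hW
    exact ⟨M, hM.1, hM.2, W, hW.1, hW.2, rfl⟩
  · rintro ⟨M, hM, hMS, W, hW, hWT, rfl⟩
    exact ⟨M, Finset.mem_filter.2 ⟨hM, hMS⟩, W, Finset.mem_filter.2 ⟨hW, hWT⟩, rfl⟩

theorem subset_amalgam_left : A ⊆ amalgam S T A B := fun _ h => mem_amalgam.2 (Or.inl h)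

theorem subset_amalgam_right : B ⊆ amalgam S T A B := fun _ h => mem_amalgam.2 (Or.inr (Or.inl h))

theorem IsNewNode.mem_amalgam (h : IsNewNode S T A B Q X W) : X ∈ amalgam S T A B := by
  obtain ⟨M, hM, hMS, -, rfl⟩ := h.exists_eq
  exact TwoTypes.mem_amalgam.2 (Or.inr (Or.inr ⟨M, hM, hMS, W, h.trans_mem, h.trans, rfl⟩))

theorem IsNewNode.mem_trans (h : IsNewNode S T A B Q X W) (hF : ModelFamily S T) : X ∈ W := by
  obtain ⟨M, -, hMS, -, rfl⟩ := h.exists_eq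
  exact (hF.inter M hMS W h.trans).2

namespace Amalgamable

/-- Cutting M by a transitive node U ∋ W does not change M ∩ W. If M lies in or can be cut down into
Q, the intersection falls in B. Otherwise M is cut down until it includes Q ∩ W, unless M ∈ W
already. -/
theorem exists_good (h : Amalgamable S T A B Q) (hF : ModelFamily S T) (hW : W ∈ B)
    (hWT : W ∈ T) (hM : M ∈ A) (hMS : M ∈ S) : M ∩ W ∈ A ∨ M ∩ W ∈ B ∨
      ∃ M' ∈ A, M' ∈ S ∧ W ∈ M' ∧ Q ∩ W ⊆ M' ∧ M ∩ W = M' ∩ W := by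
  induction hr : M.rank using WellFoundedLT.induction generalizing M with
  | ind o ih =>
    subst hr
    have hWQ := h.mem_node W hW
    by_cases hMQ : M ∈ Q
    · exact Or.inr (Or.inl (h.right.inter M (h.mem_right M hM hMQ) W hW))
    by_cases hQT : Q ∈ T
    · have hMQ' := h.mem_right _ (h.left.inter M hM Q h.node_mem) (hF.inter M hMS Q hQT).2
      have he : M ∩ Q ∩ W = M ∩ W := by
        ext z
        simp only [ZFSet.mem_inter]
        exact ⟨fun h => ⟨h.1.1, h.2⟩, fun h => ⟨⟨h.1, hF.trans Q hQT W hWQ h.2⟩, h.2⟩⟩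
      rw [← he]
      exact Or.inr (Or.inl (h.right.inter _ hMQ' W hW))
    have hQS : Q ∈ S := (h.left.node Q h.node_mem).resolve_right hQT
    -- Q' stands for Q when M is above Q, and for Q ∩ V when M is in the gap of some V above W.
    suffices hs : ∀ Q' ∈ A, Q' ∈ S → Q'.rank ≤ M.rank → W ∈ Q' → Q ∩ W ⊆ Q' →
        M ∩ W ∈ A ∨ M ∩ W ∈ B ∨ ∃ M' ∈ A, M' ∈ S ∧ W ∈ M' ∧ Q ∩ W ⊆ M' ∧ M ∩ W = M' ∩ W by
      have hMW : M ∈ W → M ∩ W ∈ A := by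
        intro hMW
        rwa [ZFSet.inter_eq_left_of_subset (hF.small_subset M hMS W (Or.inr hWT) hMW)]
      rcases h.left.mem_or_le_or_gap hF hM h.node_mem with
        h' | h' | ⟨V, hV, hVT, hVQ, -, hQV, hle, hMV⟩
      · exact absurd h' hMQ
      · exact hs Q h.node_mem hQS h' hWQ fun z hz => (ZFSet.mem_inter.1 hz).1
      · have hVB := h.mem_right V hV hVQ
        rcases lt_trichotomy W.rank V.rank with hlt | heq | hlt
        · have hWV := h.right.mem_trans_of_rank_lt hF hW hVB hVT hlt
          refine hs _ hQV (hF.inter Q hQS V hVT).1 hle (ZFSet.mem_inter.2 ⟨hWQ, hWV⟩) ?_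
          intro z hz
          rw [ZFSet.mem_inter] at hz ⊢
          exact ⟨hz.1, hF.trans V hVT W hWV hz.2⟩
        · rw [← h.right.eq_of_rank_eq hW hVB heq] at hMV
          exact Or.inl (hMW hMV)
        · exact Or.inl (hMW (hF.trans W hWT V
            (h.right.mem_trans_of_rank_lt hF hVB hW hWT hlt) hMV))
    intro Q' hQ' hQ'S hle hWQ' hsub
    rcases hle.eq_or_lt with heq | hlt
    · rw [h.left.eq_of_rank_eq hQ' hM heq] at hWQ' hsub
      exact Or.inr (Or.inr ⟨M, hM, hMS, hWQ', hsub, rfl⟩)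
    rcases h.left.mem_or_exists_trans hF hQ' hM hlt with hmem | ⟨U, hU, hUT, hQ'U, hUM⟩
    · have hQM := hF.small_subset Q' hQ'S M (Or.inl hMS) hmem
      exact Or.inr (Or.inr ⟨M, hM, hMS, hQM hWQ', fun z hz => hQM (hsub hz), rfl⟩)
    · have hWU : W ∈ U := hF.trans U hUT Q' hQ'U hWQ'
      have hi := hF.inter M hMS U hUT
      have he : M ∩ U ∩ W = M ∩ W := by
        ext z
        simp only [ZFSet.mem_inter]
        exact ⟨fun h => ⟨h.1.1, h.2⟩, fun h => ⟨⟨h.1, hF.trans U hUT W hWU h.2⟩, h.2⟩⟩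
      rw [← he]
      exact ih _ ((ZFSet.rank_lt_of_mem hi.2).trans hUM) (h.left.inter M hM U hU) hi.1 rfl

theorem mem_or_isNewNode (h : Amalgamable S T A B Q) (hF : ModelFamily S T)
    (hX : X ∈ amalgam S T A B) : X ∈ A ∨ X ∈ B ∨ ∃ W, IsNewNode S T A B Q X W := by
  rcases mem_amalgam.1 hX with hX | hX | ⟨M, hM, hMS, W, hW, hWT, rfl⟩
  · exact Or.inl hX
  · exact Or.inr (Or.inl hX)
  · rcases h.exists_good hF hW hWT hM hMS with h' | h' | ⟨M', hM', hMS', hWM', hsub, he⟩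
    · exact Or.inl h'
    · exact Or.inr (Or.inl h')
    · by_cases hWA : W ∈ A
      · exact Or.inl (h.left.inter M hM W hWA)
      · refine Or.inr (Or.inr ⟨W, ⟨M', hM', hMS', hWM', he⟩, hW, hWT, fun z hz => ?_, hWA⟩)
        rw [he]
        exact ZFSet.mem_inter.2 ⟨hsub hz, (ZFSet.mem_inter.1 hz).2⟩

theorem mem_newNode (h : Amalgamable S T A B Q) (hF : ModelFamily S T)
    (hX : IsNewNode S T A B Q X W) (hN : N ∈ B) (hlt : N.rank < W.rank) : N ∈ X :=
  hX.subset (ZFSet.mem_inter.2 ⟨h.mem_node N hN,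
    h.right.mem_trans_of_rank_lt hF hN hX.trans_mem hX.trans hlt⟩)

theorem below_of_mem_of_le (h : Amalgamable S T A B Q) (hN : N ∈ B) {P : ZFSet.{u}} (hP : P ∈ A)
    (hNP : N ∈ P) (hM : M ∈ A) (hle : P.rank ≤ M.rank) : Below (amalgam S T A B) N M := by
  have h1 := Below.of_mem (subset_amalgam_right hN) (subset_amalgam_left (S := S) (T := T) hP) hNP
  rcases hle.eq_or_lt with heq | hlt
  · rwa [← h.left.eq_of_rank_eq hP hM heq]
  · exact h1.trans ((h.left.below_of_rank_lt hP hM hlt).mono subset_amalgam_left)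

/-- If M is above Q, the path from N enters through N ∈ Q. If M is in the gap of V, then N is an
element of Q ∩ V and so below M, or it is V or above it, while M ∈ V. -/
theorem comparable_left_right (h : Amalgamable S T A B Q) (hF : ModelFamily S T) (hM : M ∈ A)
    (hN : N ∈ B) : M = N ∨ Below (amalgam S T A B) M N ∨ Below (amalgam S T A B) N M := by
  have hright : ∀ M ∈ B, M = N ∨ Below (amalgam S T A B) M N ∨ Below (amalgam S T A B) N M := by
    intro M hM
    rcases h.right.eq_or_below hM hN with h' | h' | h'
    · exact Or.inl h'
    · exact Or.inr (Or.inl (h'.mono subset_amalgam_right))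
    · exact Or.inr (Or.inr (h'.mono subset_amalgam_right))
  rcases h.left.mem_or_le_or_gap hF hM h.node_mem with
    h' | h' | ⟨V, hV, hVT, hVQ, -, hQV, hle, hMV⟩
  · exact hright M (h.mem_right M hM h')
  · exact Or.inr (Or.inr (h.below_of_mem_of_le hN h.node_mem (h.mem_node N hN) hM h'))
  · have hVB := h.mem_right V hV hVQ
    have hMV' := Below.of_mem (subset_amalgam_left (S := S) (T := T) (B := B) hM)
      (subset_amalgam_left hV) hMV
    rcases hright V hVB with rfl | h' | h'
    · exact Or.inr (Or.inl hMV')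
    · exact Or.inr (Or.inl (hMV'.trans h'))
    · refine Or.inr (Or.inr (h.below_of_mem_of_le hN hQV (ZFSet.mem_inter.2
        ⟨h.mem_node N hN, ?_⟩) hM hle))
      exact h.right.mem_trans_of_rank_lt hF hN hVB hVT h'.rank_lt

theorem comparable_newNode_right (h : Amalgamable S T A B Q) (hF : ModelFamily S T)
    (hX : IsNewNode S T A B Q X W) (hN : N ∈ B) :
    Below (amalgam S T A B) X N ∨ Below (amalgam S T A B) N X := by
  have hXW := Below.of_mem hX.mem_amalgam (subset_amalgam_right hX.trans_mem) (hX.mem_trans hF)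
  rcases lt_trichotomy N.rank W.rank with hlt | heq | hlt
  · exact Or.inr (Below.of_mem (subset_amalgam_right hN) hX.mem_amalgam
      (h.mem_newNode hF hX hN hlt))
  · rw [h.right.eq_of_rank_eq hN hX.trans_mem heq]
    exact Or.inl hXW
  · exact Or.inl (hXW.trans ((h.right.below_of_rank_lt hX.trans_mem hN hlt).mono
      subset_amalgam_right))

/-- For M in the gap of V, the case W = V is excluded because V ∈ A and W ∉ A. So the new node is
below Q ∩ V or contains V. -/
theorem comparable_newNode_left (h : Amalgamable S T A B Q) (hF : ModelFamily S T)
    (hX : IsNewNode S T A B Q X W) (hM : M ∈ A) :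
    Below (amalgam S T A B) X M ∨ Below (amalgam S T A B) M X := by
  have hXW := Below.of_mem hX.mem_amalgam (subset_amalgam_right hX.trans_mem) (hX.mem_trans hF)
  rcases h.left.mem_or_le_or_gap hF hM h.node_mem with
    h' | h' | ⟨V, hV, hVT, hVQ, -, hQV, hle, hMV⟩
  · exact h.comparable_newNode_right hF hX (h.mem_right M hM h')
  · exact Or.inl (hXW.trans (h.below_of_mem_of_le hX.trans_mem h.node_mem
      (h.mem_node W hX.trans_mem) hM h'))
  · have hVB := h.mem_right V hV hVQ
    rcases lt_trichotomy W.rank V.rank with hlt | heq | hlt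
    · exact Or.inl (hXW.trans (h.below_of_mem_of_le hX.trans_mem hQV (ZFSet.mem_inter.2
        ⟨h.mem_node W hX.trans_mem,
          h.right.mem_trans_of_rank_lt hF hX.trans_mem hVB hVT hlt⟩) hM hle))
    · exact absurd (h.right.eq_of_rank_eq hX.trans_mem hVB heq ▸ hV) hX.notMem
    · exact Or.inr ((Below.of_mem (subset_amalgam_left hM) (subset_amalgam_left hV) hMV).trans
        (Below.of_mem (subset_amalgam_left hV) hX.mem_amalgam (h.mem_newNode hF hX hVB hlt)))

theorem comparable_newNode_newNode (h : Amalgamable S T A B Q) (hF : ModelFamily S T)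
    {V : ZFSet.{u}} (hX : IsNewNode S T A B Q X W) (hY : IsNewNode S T A B Q Y V) :
    X = Y ∨ Below (amalgam S T A B) X Y ∨ Below (amalgam S T A B) Y X := by
  have hXW := Below.of_mem hX.mem_amalgam (subset_amalgam_right hX.trans_mem) (hX.mem_trans hF)
  have hYV := Below.of_mem hY.mem_amalgam (subset_amalgam_right hY.trans_mem) (hY.mem_trans hF)
  rcases lt_trichotomy W.rank V.rank with hlt | heq | hlt
  · exact Or.inr (Or.inl (hXW.trans (Below.of_mem (subset_amalgam_right hX.trans_mem)
      hY.mem_amalgam (h.mem_newNode hF hY hX.trans_mem hlt))))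
  · obtain rfl := h.right.eq_of_rank_eq hX.trans_mem hY.trans_mem heq
    obtain ⟨M, hM, hMS, hWM, hXM⟩ := hX.exists_eq
    obtain ⟨N, hN, hNS, hWN, hYN⟩ := hY.exists_eq
    have := h.left.inter_trans_comparable hF hX.trans _ M hM hMS hWM (le_max_left _ N.rank)
      N hN hNS hWN (le_max_right _ _)
    rw [← hXM, ← hYN] at this
    exact this.imp_right (Or.imp (Below.of_mem hX.mem_amalgam hY.mem_amalgam)
      (Below.of_mem hY.mem_amalgam hX.mem_amalgam))
  · exact Or.inr (Or.inr (hYV.trans (Below.of_mem (subset_amalgam_right hY.trans_mem)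
      hX.mem_amalgam (h.mem_newNode hF hX hY.trans_mem hlt))))

theorem comparable (h : Amalgamable S T A B Q) (hF : ModelFamily S T)
    (hX : X ∈ amalgam S T A B) (hY : Y ∈ amalgam S T A B) :
    X = Y ∨ Below (amalgam S T A B) X Y ∨ Below (amalgam S T A B) Y X := by
  rcases h.mem_or_isNewNode hF hX with hX' | hX' | ⟨W, hX'⟩ <;>
  rcases h.mem_or_isNewNode hF hY with hY' | hY' | ⟨V, hY'⟩
  · exact (h.left.eq_or_below hX' hY').imp_right
      (Or.imp (Below.mono subset_amalgam_left) (Below.mono subset_amalgam_left))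
  · exact h.comparable_left_right hF hX' hY'
  · exact Or.inr (h.comparable_newNode_left hF hY' hX').symm
  · exact (h.comparable_left_right hF hY' hX').imp Eq.symm Or.symm
  · exact (h.right.eq_or_below hX' hY').imp_right
      (Or.imp (Below.mono subset_amalgam_right) (Below.mono subset_amalgam_right))
  · exact Or.inr (h.comparable_newNode_right hF hY' hX').symm
  · exact Or.inr (h.comparable_newNode_left hF hX' hY')
  · exact Or.inr (h.comparable_newNode_right hF hX' hY')
  · exact h.comparable_newNode_newNode hF hX' hY'

/-- A small N is a subset of Q, so M may be replaced by M ∩ Q, which is in Q, is Q, or is Q ∩ V;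
each time the intersection is in B. For N transitive and M small it is in the amalgam by definition;
two transitive nodes outside B are handled by inclusion. -/
theorem inter_mem_left_right (h : Amalgamable S T A B Q) (hF : ModelFamily S T) (hM : M ∈ A)
    (hN : N ∈ B) : M ∩ N ∈ amalgam S T A B := by
  have hNQ := h.mem_node N hN
  rcases h.right.node N hN with hNS | hNT
  · have hsub := hF.small_subset N hNS Q (h.left.node Q h.node_mem) hNQ
    have he : M ∩ N = M ∩ Q ∩ N := by
      ext z
      simp only [ZFSet.mem_inter]
      exact ⟨fun h => ⟨⟨h.1, hsub h.2⟩, h.2⟩, fun h => ⟨h.1.1, h.2⟩⟩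
    rw [he]
    refine subset_amalgam_right ?_
    rcases h.left.inter_mem_or_eq hF hM h.node_mem with h' | h' | ⟨V, hV, hVT, hVQ, -, h'⟩
    · exact h.right.inter _ (h.mem_right _ (h.left.inter M hM Q h.node_mem) h') N hN
    · rwa [h', ZFSet.inter_eq_right_of_subset hsub]
    · have he' : Q ∩ V ∩ N = V ∩ N := by
        ext z
        simp only [ZFSet.mem_inter]
        exact ⟨fun h => ⟨h.1.2, h.2⟩, fun h => ⟨⟨hsub h.2, h.1⟩, h.2⟩⟩
      rw [h', he']
      exact h.right.inter V (h.mem_right V hV hVQ) N hN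
  · rcases h.left.node M hM with hMS | hMT
    · exact mem_amalgam.2 (Or.inr (Or.inr ⟨M, hM, hMS, N, hN, hNT, rfl⟩))
    · have hNM : N ∈ M → M ∩ N ∈ amalgam S T A B := fun hNM => by
        rw [ZFSet.inter_eq_right_of_subset (hF.trans M hMT N hNM)]
        exact subset_amalgam_right hN
      have hQM : ∀ P ∈ A, N ∈ P → P.rank ≤ M.rank → N ∈ M := by
        intro P hP hNP hle
        rcases hle.eq_or_lt with heq | hlt
        · rwa [← h.left.eq_of_rank_eq hP hM heq]
        · exact hF.trans M hMT P (h.left.mem_trans_of_rank_lt hF hP hM hMT hlt) hNP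
      rcases h.left.mem_or_le_or_gap hF hM h.node_mem with
        h' | h' | ⟨V, hV, hVT, hVQ, -, hQV, hle, hMV⟩
      · exact subset_amalgam_right (h.right.inter M (h.mem_right M hM h') N hN)
      · exact hNM (hQM Q h.node_mem hNQ h')
      · have hVB := h.mem_right V hV hVQ
        have hMN : M ∈ N → M ∩ N ∈ amalgam S T A B := fun hMN => by
          rw [ZFSet.inter_eq_left_of_subset (hF.trans N hNT M hMN)]
          exact subset_amalgam_left hM
        rcases lt_trichotomy N.rank V.rank with hlt | heq | hlt
        · exact hNM (hQM _ hQV (ZFSet.mem_inter.2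
            ⟨hNQ, h.right.mem_trans_of_rank_lt hF hN hVB hVT hlt⟩) hle)
        · rw [← h.right.eq_of_rank_eq hN hVB heq] at hMV
          exact hMN hMV
        · exact hMN (hF.trans N hNT V (h.right.mem_trans_of_rank_lt hF hVB hN hNT hlt) hMV)

theorem inter_mem (h : Amalgamable S T A B Q) (hF : ModelFamily S T)
    (hX : X ∈ amalgam S T A B) (hY : Y ∈ amalgam S T A B) : X ∩ Y ∈ amalgam S T A B := by
  have hAB : ∀ {M N : ZFSet.{u}}, M ∈ A → N ∈ B → M ∩ N ∈ amalgam S T A B := h.inter_mem_left_right hF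
  rcases mem_amalgam.1 hX with hX | hX | ⟨M, hM, -, W, hW, -, rfl⟩ <;>
  rcases mem_amalgam.1 hY with hY | hY | ⟨N, hN, -, V, hV, -, rfl⟩
  · exact subset_amalgam_left (h.left.inter X hX Y hY)
  · exact hAB hX hY
  · rw [(by ext; simp [and_assoc] : X ∩ (N ∩ V) = X ∩ N ∩ V)]
    exact hAB (h.left.inter X hX N hN) hV
  · rw [(by ext; simp [and_comm] : X ∩ Y = Y ∩ X)]
    exact hAB hY hX
  · exact subset_amalgam_right (h.right.inter X hX Y hY)
  · rw [(by ext; simp [and_left_comm] : X ∩ (N ∩ V) = N ∩ (X ∩ V))]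
    exact hAB hN (h.right.inter X hX V hV)
  · rw [(by ext; simp [and_right_comm] : M ∩ W ∩ Y = M ∩ Y ∩ W)]
    exact hAB (h.left.inter M hM Y hY) hW
  · rw [(by ext; simp [and_assoc] : M ∩ W ∩ Y = M ∩ (W ∩ Y))]
    exact hAB hM (h.right.inter W hW Y hY)
  · rw [(by ext; simp [and_and_and_comm] : M ∩ W ∩ (N ∩ V) = M ∩ N ∩ (W ∩ V))]
    exact hAB (h.left.inter M hM N hN) (h.right.inter W hW V hV)

theorem isSideCondition (h : Amalgamable S T A B Q) (hF : ModelFamily S T) :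
    IsSideCondition S T (amalgam S T A B) where
  chain := exists_chain_of_below fun _ hX _ hY => h.comparable hF hX hY
  node X hX := by
    rcases mem_amalgam.1 hX with hX | hX | ⟨M, hM, hMS, W, hW, hWT, rfl⟩
    · exact h.left.node X hX
    · exact h.right.node X hX
    · exact Or.inl (hF.inter M hMS W hWT).1
  inter _ hX _ hY := h.inter_mem hF hX hY

theorem mem_interClosure_iff (h : Amalgamable S T A B Q) (hF : ModelFamily S T) :
    X ∈ amalgam S T A B ↔ InterClosure {N | N ∈ A ∨ N ∈ B} X := by
  constructor
  · intro hX
    rcases mem_amalgam.1 hX with hX | hX | ⟨M, hM, -, W, hW, -, rfl⟩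
    · exact InterClosure.base (Or.inl hX)
    · exact InterClosure.base (Or.inr hX)
    · exact InterClosure.inter (InterClosure.base (Or.inl hM)) (InterClosure.base (Or.inr hW))
  · intro hX
    induction hX with
    | base hX => exact mem_amalgam.2 (hX.imp_right Or.inl)
    | inter _ _ ih ih' => exact h.inter_mem hF ih ih'

/-- A new node X in Q would be an element of Q ∩ W ⊆ X. -/
theorem mem_amalgam_and_mem_iff (h : Amalgamable S T A B Q) (hF : ModelFamily S T) :
    X ∈ amalgam S T A B ∧ X ∈ Q ↔ X ∈ B := by
  refine ⟨fun ⟨hX, hXQ⟩ => ?_, fun hX => ⟨subset_amalgam_right hX, h.mem_node X hX⟩⟩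
  rcases h.mem_or_isNewNode hF hX with hX | hX | ⟨W, hX⟩
  · exact h.mem_right X hX hXQ
  · exact hX
  · exact absurd (hX.subset (ZFSet.mem_inter.2 ⟨hXQ, hX.mem_trans hF⟩)) (ZFSet.mem_irrefl X)

/-- The decoration of M in q belongs to Q and to every transitive node W of q above M. The
alternatives for the successor are those for which this suffices. -/
theorem succ_of_mem_right (h : Amalgamable S T A B Q) (hF : ModelFamily S T)
    (hs : IsSuccNode (amalgam S T A B) M N) (hM : M ∈ B) :
    N ∈ B ∨ N = Q ∨ ∃ W ∈ B, W ∈ T ∧ M.rank < W.rank ∧ Q ∩ W ⊆ N := by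
  obtain ⟨-, hN, hlt, hbt⟩ := hs
  by_cases hNB : N ∈ B
  · exact Or.inl hNB
  have hle : ∀ P ∈ A, M ∈ P → P.rank ≤ N.rank → P.rank = N.rank := fun P hP hMP hle =>
    hle.eq_or_lt.resolve_right fun hPN =>
      hbt P (subset_amalgam_left hP) ⟨ZFSet.rank_lt_of_mem hMP, hPN⟩
  rcases h.mem_or_isNewNode hF hN with hNA | hN | ⟨W, hN⟩
  · rcases h.left.mem_or_le_or_gap hF hNA h.node_mem with
      h' | h' | ⟨V, hV, hVT, hVQ, -, hQV, hle', hNV⟩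
    · exact absurd (h.mem_right N hNA h') hNB
    · exact Or.inr (Or.inl (h.left.eq_of_rank_eq hNA h.node_mem
        (hle Q h.node_mem (h.mem_node M hM) h').symm))
    · have hVB := h.mem_right V hV hVQ
      have hMV := hlt.trans (ZFSet.rank_lt_of_mem hNV)
      have hMQV : M ∈ Q ∩ V := ZFSet.mem_inter.2
        ⟨h.mem_node M hM, h.right.mem_trans_of_rank_lt hF hM hVB hVT hMV⟩
      refine Or.inr (Or.inr ⟨V, hVB, hVT, hMV, ?_⟩)
      rw [h.left.eq_of_rank_eq hQV hNA (hle _ hQV hMQV hle')]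
  · exact absurd hN hNB
  · exact Or.inr (Or.inr ⟨W, hN.trans_mem, hN.trans,
      hlt.trans (ZFSet.rank_lt_of_mem (hN.mem_trans hF)), hN.subset⟩)

/-- From Q upwards all nodes come from A, and so do those strictly inside a gap [Q ∩ V, V): nodes of
B and new nodes have rank below Q ∩ V or at least that of V. -/
theorem succ_of_mem_left (h : Amalgamable S T A B Q) (hF : ModelFamily S T)
    (hs : IsSuccNode (amalgam S T A B) M N) (hM : M ∈ A) (hMB : M ∉ B) : N ∈ A := by
  obtain ⟨-, hN, hlt, hbt⟩ := hs
  have hnot : ∀ {P : ZFSet.{u}}, N ∈ P → P.rank ≤ M.rank → False := fun hNP hle =>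
    ((ZFSet.rank_lt_of_mem hNP).trans_le hle).not_gt hlt
  have hWnot : ∀ {P W : ZFSet.{u}}, IsNewNode S T A B Q N W → W ∈ P → P.rank ≤ M.rank → False :=
    fun hN hWP hle => (((ZFSet.rank_lt_of_mem (hN.mem_trans hF)).trans
      (ZFSet.rank_lt_of_mem hWP)).trans_le hle).not_gt hlt
  rcases h.left.mem_or_le_or_gap hF hM h.node_mem with
    h' | h' | ⟨V, hV, hVT, hVQ, -, hQV, hle, hMV⟩
  · exact absurd (h.mem_right M hM h') hMB
  · rcases h.mem_or_isNewNode hF hN with hN | hN | ⟨W, hN⟩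
    · exact hN
    · exact (hnot (h.mem_node N hN) h').elim
    · exact (hWnot hN (h.mem_node W hN.trans_mem) h').elim
  · have hVB := h.mem_right V hV hVQ
    have hNV : N.rank ≤ V.rank := le_of_not_gt fun hVN =>
      hbt V (subset_amalgam_left hV) ⟨ZFSet.rank_lt_of_mem hMV, hVN⟩
    rcases h.mem_or_isNewNode hF hN with hN | hN | ⟨W, hN⟩
    · exact hN
    · rcases hNV.eq_or_lt with heq | hlt'
      · rwa [h.right.eq_of_rank_eq hN hVB heq]
      · exact (hnot (ZFSet.mem_inter.2 ⟨h.mem_node N hN,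
          h.right.mem_trans_of_rank_lt hF hN hVB hVT hlt'⟩) hle).elim
    · rcases lt_trichotomy W.rank V.rank with hlt' | heq | hlt'
      · exact (hWnot hN (ZFSet.mem_inter.2 ⟨h.mem_node W hN.trans_mem,
          h.right.mem_trans_of_rank_lt hF hN.trans_mem hVB hVT hlt'⟩) hle).elim
      · exact absurd (h.right.eq_of_rank_eq hN.trans_mem hVB heq ▸ hV) hN.notMem
      · exact absurd (ZFSet.rank_lt_of_mem (h.mem_newNode hF hN hVB hlt')) hNV.not_gt

end Amalgamable

/-! ### Traces on ω₁, heights and codes of conditions -/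

section Appropriate

variable {L : FirstOrder.Language.{v, w}} {K : ZFSet.{u}} [L.Structure (Carrier K)]
  {S T : Set ZFSet.{u}} {M N : ZFSet.{u}}

theorem IsAppropriate.isElemSub (hST : IsAppropriate L K S T) (hM : M ∈ S ∪ T) : IsElemSub K M :=
  hM.elim (fun h => (hST.small_elem M h).isElemSub) (fun h => (hST.trans_elem M h).isElemSub)

theorem IsAppropriate.small_subset (hST : IsAppropriate L K S T) (hK : IsTransitiveModel K)
    (hω : CorrectOmegaOne K) (hM : M ∈ S) (hN : N ∈ S ∪ T) (h : M ∈ N) : M ⊆ N :=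
  (hST.isElemSub hN).subset_of_countable hK hω h (hST.small_countable M hM)

theorem IsAppropriate.modelFamily (hST : IsAppropriate L K S T) (hK : IsTransitiveModel K)
    (hω : CorrectOmegaOne K) : ModelFamily S T where
  small_subset _ hM _ hN h := hST.small_subset hK hω hM hN h
  trans := hST.trans_transitive
  inter := hST.inter_mem
  inter_closed _ hN _ hM _ hW := (hST.isElemSub hN).inter_mem hK hM hW

theorem IsAppropriate.omegaOne_subset (hST : IsAppropriate L K S T) (hK : IsTransitiveModel K)
    (hω : CorrectOmegaOne K) (hM : M ∈ T) : omegaOne ⊆ M :=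
  hST.trans_transitive M hM _ ((hST.isElemSub (Or.inr hM)).omegaOne_mem hK hω)

/-- The ordinal `M ∩ ω₁` of a countable elementary submodel `M`. -/
noncomputable def delta (M : ZFSet.{u}) : Ordinal.{u} := (M ∩ omegaOne).rank

theorem IsElemSub.toZFSet_delta {M : ZFSet.{u}} (hM : IsElemSub K M) (hK : IsTransitiveModel K)
    (hω : CorrectOmegaOne K) : (delta M).toZFSet = M ∩ omegaOne := by
  refine ZFSet.IsOrdinal.toZFSet_rank_eq (ZFSet.isOrdinal_iff_forall_mem_isOrdinal.2
    ⟨fun x hx y hy => ?_, fun x hx => ?_⟩)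
  · obtain ⟨hxM, hx1⟩ := ZFSet.mem_inter.1 hx
    obtain ⟨o, ho, rfl⟩ := Ordinal.mem_toZFSet_iff.1 hx1
    exact ZFSet.mem_inter.2 ⟨hM.countable_ordinal_subset hK hω ho hxM hy,
      (ZFSet.isOrdinal_toZFSet _).mem_trans hy hx1⟩
  · exact (ZFSet.isOrdinal_toZFSet _).mem (ZFSet.mem_inter.1 hx).2

/-- This turns the order type clause of a condition into an implication between inequalities of
ordinals. -/
theorem IsElemSub.toZFSet_mem_iff {M : ZFSet.{u}} (hM : IsElemSub K M) (hK : IsTransitiveModel K)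
    (hω : CorrectOmegaOne K) {o : Ordinal.{u}} (ho : o < ω₁) : o.toZFSet ∈ M ↔ o < delta M := by
  rw [← Ordinal.toZFSet_mem_toZFSet_iff, hM.toZFSet_delta hK hω, ZFSet.mem_inter]
  exact ⟨fun h => ⟨h, Ordinal.toZFSet_mem_toZFSet_iff.2 ho⟩, fun h => h.1⟩

theorem IsElemSub.delta_lt {M : ZFSet.{u}} (hM : IsElemSub K M) (hK : IsTransitiveModel K)
    (hω : CorrectOmegaOne K) (hc : (M : Set ZFSet.{u}).Countable) : delta M < ω₁ := by
  rw [lt_omegaOne_iff_countable, hM.toZFSet_delta hK hω]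
  exact hc.mono fun x hx => (ZFSet.mem_inter.1 hx).1

end Appropriate

section Height

variable {K : ZFSet.{u}} {S : Set ZFSet.{u}} {A : Finset ZFSet.{u}}

theorem exists_height {α ξ : Ordinal.{u}} {M : ZFSet.{u}} (hM : M ∈ A) (hMS : M ∈ S)
    (hα : α.toZFSet ∈ M) (hξ : M ∩ omegaOne = ξ.toZFSet) : ∃ β, Height K S A α ξ β := by
  classical
  obtain ⟨N, hN, hmax⟩ := (A.filter fun N => N ∈ S ∧ α.toZFSet ∈ N ∧
    N ∩ omegaOne = ξ.toZFSet).exists_max_image (otp K) ⟨M, Finset.mem_filter.2 ⟨hM, hMS, hα, hξ⟩⟩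
  obtain ⟨hNA, hNS, hNα, hNξ⟩ := Finset.mem_filter.1 hN
  refine ⟨otp K N, ⟨N, hNA, hNS, hNα, hNξ, rfl⟩, ?_⟩
  rintro γ ⟨P, hP, hPS, hPα, hPξ, rfl⟩
  exact hmax P (Finset.mem_filter.2 ⟨hP, hPS, hPα, hPξ⟩)

end Height

section Code

variable {K Q : ZFSet.{u}} {q : DecPair.{u}}

theorem DecPair.countable_nodeSet (q : DecPair.{u}) : (q.nodeSet : Set ZFSet.{u}).Countable := by
  rw [DecPair.nodeSet, ZFSet.coe_range]
  exact Set.countable_range _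

theorem DecPair.countable_decoSet (q : DecPair.{u}) : (q.decoSet : Set ZFSet.{u}).Countable := by
  rw [DecPair.decoSet, ZFSet.coe_range]
  exact Set.countable_range _

theorem IsElemSub.node_mem (hQ : IsElemSub K Q) (hK : IsTransitiveModel K)
    (hω : CorrectOmegaOne K) (h : q.code ∈ Q) {M : ZFSet.{u}} (hM : M ∈ q.nodes) : M ∈ Q :=
  hQ.subset_of_countable hK hω (hQ.fst_snd_mem hK h).1 q.countable_nodeSet
    (ZFSet.mem_range.2 ⟨⟨M, hM⟩, rfl⟩)

theorem IsElemSub.deco_mem (hQ : IsElemSub K Q) (hK : IsTransitiveModel K)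
    (hω : CorrectOmegaOne K) (h : q.code ∈ Q) {M : ZFSet.{u}} (hM : M ∈ q.nodes) :
    q.deco M ∈ Q :=
  (hQ.fst_snd_mem hK (hQ.subset_of_countable hK hω (hQ.fst_snd_mem hK h).2 q.countable_decoSet
    (ZFSet.mem_range.2 ⟨⟨M, hM⟩, rfl⟩))).2

theorem IsDecorated.deco_mem_trans {S T : Set ZFSet.{u}} (hq : IsDecorated K S T q)
    (hF : ModelFamily S T) {M W : ZFSet.{u}} (hM : M ∈ q.nodes) (hW : W ∈ q.nodes) (hWT : W ∈ T)
    (hlt : M.rank < W.rank) : q.deco M ∈ W := by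
  classical
  obtain ⟨N, hN, hmin⟩ := (q.nodes.filter fun N => M.rank < N.rank).exists_min_image ZFSet.rank
    ⟨W, Finset.mem_filter.2 ⟨hW, hlt⟩⟩
  obtain ⟨hN, hMN⟩ := Finset.mem_filter.1 hN
  have hd := hq.deco_succ M N ⟨hM, hN, hMN, fun P hP hbt =>
    (hmin P (Finset.mem_filter.2 ⟨hP, hbt.1⟩)).not_gt hbt.2⟩
  rcases (hmin W (Finset.mem_filter.2 ⟨hW, hlt⟩)).eq_or_lt with h | h
  · rwa [← hq.side.eq_of_rank_eq hN hW h]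
  · exact hF.trans W hWT N (hq.side.mem_trans_of_rank_lt hF hN hW hWT h) hd

end Code

/-! ### Decorations, heights and order types of the amalgam -/

section Amalgamation

open Classical in
/-- The amalgamation of `p` and its reflection `q`. -/
noncomputable def amalgamPair (S T : Set ZFSet.{u}) (p q : DecPair.{u}) : DecPair.{u} where
  nodes := amalgam S T p.nodes q.nodes
  deco M := if M ∈ q.nodes then q.deco M else p.deco M

variable {L : FirstOrder.Language.{v, w}} {K : ZFSet.{u}} [L.Structure (Carrier K)]
  {S T : Set ZFSet.{u}} {p q : DecPair.{u}} {Q M X : ZFSet.{u}}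

theorem amalgamPair_deco_of_mem (h : M ∈ q.nodes) : (amalgamPair S T p q).deco M = q.deco M :=
  if_pos h

theorem amalgamPair_deco_of_notMem (h : M ∉ q.nodes) : (amalgamPair S T p q).deco M = p.deco M :=
  if_neg h

theorem IsReflection.amalgamable (hq : IsReflection K S T p Q q) (hST : IsAppropriate L K S T)
    (hK : IsTransitiveModel K) (hω : CorrectOmegaOne K) (hp : IsCond K S T p)
    (hQp : Q ∈ p.nodes) : Amalgamable S T p.nodes q.nodes Q where
  left := hp.decorated.side
  right := hq.cond.decorated.side
  node_mem := hQp
  mem_node _ hN :=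
    (hST.isElemSub (hp.decorated.side.node Q hQp)).node_mem hK hω hq.code_mem hN
  mem_right := hq.nodes_subset

theorem IsReflection.isDecorated (hq : IsReflection K S T p Q q) (hST : IsAppropriate L K S T)
    (hK : IsTransitiveModel K) (hω : CorrectOmegaOne K) (hp : IsCond K S T p)
    (hQp : Q ∈ p.nodes) : IsDecorated K S T (amalgamPair S T p q) := by
  have hF := hST.modelFamily hK hω
  have hD := hq.amalgamable hST hK hω hp hQp
  have hside := hD.isSideCondition hF
  have hQ := hST.isElemSub (hp.decorated.side.node Q hQp)
  have hpd : ∀ M, p.deco M ∈ K ∧ (p.deco M : Set ZFSet.{u}).Finite := by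
    intro M
    by_cases hM : M ∈ p.nodes
    · exact ⟨hp.decorated.deco_mem M hM, hp.decorated.deco_finite M hM⟩
    · rw [hp.decorated.deco_off M hM]
      exact ⟨hQ.mem_K (hQ.empty_mem hK), by simp⟩
  refine ⟨hside, fun M hM => ?_, fun M _ => ?_, fun M _ => ?_, fun M N hMN => ?_⟩
  · rw [amalgamPair_deco_of_notMem fun h => hM (subset_amalgam_right h)]
    exact hp.decorated.deco_off M fun h => hM (subset_amalgam_left h)
  · by_cases hM : M ∈ q.nodes
    · rw [amalgamPair_deco_of_mem hM]
      exact hq.cond.decorated.deco_mem M hM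
    · rw [amalgamPair_deco_of_notMem hM]
      exact (hpd M).1
  · by_cases hM : M ∈ q.nodes
    · rw [amalgamPair_deco_of_mem hM]
      exact hq.cond.decorated.deco_finite M hM
    · rw [amalgamPair_deco_of_notMem hM]
      exact (hpd M).2
  · by_cases hM : M ∈ q.nodes
    · rw [amalgamPair_deco_of_mem hM]
      have hdQ := hQ.deco_mem hK hω hq.code_mem hM
      -- Successors in the amalgam that remain within q are successors in q; the other two cases use
      -- that the decoration is in Q, respectively in Q ∩ W.
      rcases hD.succ_of_mem_right hF hMN hM with hN | rfl | ⟨W, hW, hWT, hlt, hsub⟩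
      · exact hq.cond.decorated.deco_succ M N ⟨hM, hN, hMN.2.2.1, fun P hP =>
          hMN.2.2.2 P (subset_amalgam_right hP)⟩
      · exact hdQ
      · exact hsub (ZFSet.mem_inter.2 ⟨hdQ, hq.cond.decorated.deco_mem_trans hF hM hW hWT hlt⟩)
    · rw [amalgamPair_deco_of_notMem hM]
      by_cases hMp : M ∈ p.nodes
      · exact hp.decorated.deco_succ M N ⟨hMp, hD.succ_of_mem_left hF hMN hMp hM, hMN.2.2.1,
          fun P hP => hMN.2.2.2 P (subset_amalgam_left hP)⟩
      · rw [hp.decorated.deco_off M hMp]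
        exact (hST.isElemSub (hside.node N hMN.2.1)).empty_mem hK

/-- Small nodes of the amalgamation that do not come from `q` are initial segments of small nodes
of `p`. -/
theorem IsAppropriate.mem_right_or_exists_left (hST : IsAppropriate L K S T)
    (hK : IsTransitiveModel K) (hω : CorrectOmegaOne K) (hX : X ∈ amalgam S T p.nodes q.nodes)
    (hXS : X ∈ S) : X ∈ q.nodes ∨
      ∃ M ∈ p.nodes, M ∈ S ∧ X ⊆ M ∧ X ∩ omegaOne = M ∩ omegaOne := by
  rcases mem_amalgam.1 hX with hX | hX | ⟨M, hM, hMS, W, hW, hWT, rfl⟩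
  · exact Or.inr ⟨X, hX, hXS, fun _ h => h, rfl⟩
  · exact Or.inl hX
  · refine Or.inr ⟨M, hM, hMS, fun z hz => (ZFSet.mem_inter.1 hz).1, ?_⟩
    ext z
    simp only [ZFSet.mem_inter]
    exact ⟨fun h => ⟨h.1.1, h.2⟩, fun h => ⟨⟨h.1, hST.omegaOne_subset hK hω hWT h.2⟩, h.2⟩⟩

theorem IsReflection.pair_mem (hq : IsReflection K S T p Q q) (hST : IsAppropriate L K S T)
    (hK : IsTransitiveModel K) (hω : CorrectOmegaOne K) (hQ : Q ∈ S ∪ T) (hX : X ∈ q.nodes)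
    (hXS : X ∈ S) {α ξ : Ordinal.{u}} (hα : α.toZFSet ∈ X) (hξ : X ∩ omegaOne = ξ.toZFSet) :
    ZFSet.pair α.toZFSet ξ.toZFSet ∈ Q := by
  have hQ' := hST.isElemSub hQ
  have hXQ := hQ'.node_mem hK hω hq.code_mem hX
  refine hQ'.pair_mem hK (hST.small_subset hK hω hXS hQ hXQ hα) ?_
  rw [← hξ]
  exact hQ'.inter_mem hK hXQ (hQ'.omegaOne_mem hK hω)

/-- A competing node in q has α and its trace in Q, so the reflection bounds it by the height of p;
any other one is included in a small node of p with the same trace. -/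
theorem IsReflection.height_left (hq : IsReflection K S T p Q q) (hST : IsAppropriate L K S T)
    (hK : IsTransitiveModel K) (hω : CorrectOmegaOne K) (hQ : Q ∈ S ∪ T) {α ξ β : Ordinal.{u}}
    (h : Height K S p.nodes α ξ β) : Height K S (amalgam S T p.nodes q.nodes) α ξ β := by
  obtain ⟨⟨M, hM, hM'⟩, hmax⟩ := h
  refine ⟨⟨M, subset_amalgam_left hM, hM'⟩, ?_⟩
  rintro γ ⟨X, hX, hXS, hXα, hXξ, rfl⟩
  rcases hST.mem_right_or_exists_left hK hω hX hXS with hX | ⟨N, hN, hNS, hXN, he⟩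
  · exact (hq.height_extends α ξ β ⟨⟨M, hM, hM'⟩, hmax⟩
      (hq.pair_mem hST hK hω hQ hX hXS hXα hXξ)).2 ⟨X, hX, hXS, hXα, hXξ, rfl⟩
  · exact (otp_mono hXN).trans (hmax ⟨N, hN, hNS, hXN hXα, he ▸ hXξ, rfl⟩)

/-- A competing node outside q is included in some N in p, which puts (α, ξ) in the domain of the
height of p. As the pair is in Q, the two heights agree there and bound otp(N). -/
theorem IsReflection.height_right (hq : IsReflection K S T p Q q) (hST : IsAppropriate L K S T)
    (hK : IsTransitiveModel K) (hω : CorrectOmegaOne K) (hQ : Q ∈ S ∪ T) {α ξ β : Ordinal.{u}}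
    (h : Height K S q.nodes α ξ β) : Height K S (amalgam S T p.nodes q.nodes) α ξ β := by
  obtain ⟨M, hM, hMS, hMα, hMξ, hMβ⟩ := h.1
  refine ⟨⟨M, subset_amalgam_right hM, hMS, hMα, hMξ, hMβ⟩, ?_⟩
  rintro γ ⟨X, hX, hXS, hXα, hXξ, rfl⟩
  rcases hST.mem_right_or_exists_left hK hω hX hXS with hX | ⟨N, hN, hNS, hXN, he⟩
  · exact h.2 ⟨X, hX, hXS, hXα, hXξ, rfl⟩
  · have hNα := hXN hXα
    have hNξ := he ▸ hXξ
    obtain ⟨β', hβ'⟩ := exists_height (K := K) hN hNS hNα hNξ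
    rw [h.unique (hq.height_extends α ξ β' hβ' (hq.pair_mem hST hK hω hQ hM hMS hMα hMξ))]
    exact (otp_mono hXN).trans (hβ'.2 ⟨N, hN, hNS, hNα, hNξ, rfl⟩)

theorem IsCond.otp_lt_delta (hp : IsCond K S T p) (hST : IsAppropriate L K S T)
    (hK : IsTransitiveModel K) (hω : CorrectOmegaOne K) {N : ZFSet.{u}} (hM : M ∈ p.nodes)
    (hMS : M ∈ S) (hN : N ∈ p.nodes) (hNS : N ∈ S) (h : delta N < delta M) :
    otp K N < delta M := by
  have hM' := hST.isElemSub (Or.inl hMS)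
  have hN' := hST.isElemSub (Or.inl hNS)
  rw [← hM'.toZFSet_mem_iff hK hω (otp_lt_omegaOne (hST.small_countable N hNS))]
  refine hp.height_mem M hM hMS N hN hNS ?_
  rw [← hN'.toZFSet_delta hK hω]
  exact (hM'.toZFSet_mem_iff hK hω (hN'.delta_lt hK hω (hST.small_countable N hNS))).2 h

theorem IsReflection.otp_lt_delta_of_mem_left (hq : IsReflection K S T p Q q)
    (hST : IsAppropriate L K S T) (hK : IsTransitiveModel K) (hω : CorrectOmegaOne K)
    (hp : IsCond K S T p) (hQp : Q ∈ p.nodes) {N : ZFSet.{u}} (hM : M ∈ p.nodes) (hMS : M ∈ S)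
    (hN : N ∈ q.nodes) (hNS : N ∈ S) (h : delta N < delta M) : otp K N < delta M := by
  have hF := hST.modelFamily hK hω
  have hQ := hp.decorated.side.node Q hQp
  have hQ' := hST.isElemSub hQ
  have hM' := hST.isElemSub (Or.inl hMS)
  have hMδ := hM'.delta_lt hK hω (hST.small_countable M hMS)
  have hotp := otp_lt_omegaOne (K := K) (hST.small_countable N hNS)
  by_cases hδ : (delta M).toZFSet ∈ Q
  · have he : M ∩ Q ∩ omegaOne = M ∩ omegaOne := by
      ext z
      simp only [ZFSet.mem_inter]
      refine ⟨fun h => ⟨h.1.1, h.2⟩, fun h => ⟨⟨h.1, ?_⟩, h.2⟩⟩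
      refine hQ'.countable_ordinal_subset hK hω hMδ hδ ?_
      rw [hM'.toZFSet_delta hK hω]
      exact ZFSet.mem_inter.2 h
    have hne : Q ∩ omegaOne ≠ M ∩ omegaOne := by
      intro h
      have h2 : (delta M).toZFSet ∈ Q ∩ omegaOne :=
        ZFSet.mem_inter.2 ⟨hδ, Ordinal.toZFSet_mem_toZFSet_iff.2 hMδ⟩
      rw [h, hM'.toZFSet_delta hK hω] at h2
      exact ZFSet.mem_irrefl _ h2
    -- The other alternatives would give M and Q the same trace on ω₁, whereas δ(M) ∈ Q. Thus M ∩ Q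
    -- is a node of q with the same δ as M.
    have hMQ : M ∩ Q ∈ Q := by
      rcases hp.decorated.side.inter_mem_or_eq hF hM hQp with h | h | ⟨W, hW, hWT, hWQ, -, h⟩
      · exact h
      · exact absurd (by rw [← he, h]) hne
      · refine absurd ?_ hne
        rw [← he, h]
        ext z
        simp only [ZFSet.mem_inter]
        exact ⟨fun h => ⟨⟨h.1, hST.omegaOne_subset hK hω hWT h.2⟩, h.2⟩, fun h => ⟨h.1.1, h.2⟩⟩
    have hMQp := hp.decorated.side.inter M hM Q hQp
    have hMQS : M ∩ Q ∈ S := by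
      rcases hp.decorated.side.node _ hMQp with h | h
      · exact h
      · have hc : (omegaOne : Set ZFSet.{u}).Countable :=
          (hST.small_countable M hMS).mono fun z hz =>
            (ZFSet.mem_inter.1 (hST.omegaOne_subset hK hω h hz)).1
        exact absurd (lt_omegaOne_iff_countable.2 hc) (lt_irrefl _)
    have hd : delta (M ∩ Q) = delta M := by rw [delta, he, delta]
    rw [← hd] at h ⊢
    exact hq.cond.otp_lt_delta hST hK hω (hq.nodes_subset _ hMQp hMQ) hMQS hN hNS h
  -- Here δ(Q) ≤ δ(M), and N ∈ Q gives otp(N) ∈ Q by elementarity.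
  · have hNQ := hQ'.node_mem hK hω hq.code_mem hN
    rw [hQ'.toZFSet_mem_iff hK hω hMδ, not_lt] at hδ
    exact ((hQ'.toZFSet_mem_iff hK hω hotp).1 (hQ'.toZFSet_otp_mem hK hNQ)).trans_le hδ

theorem IsReflection.otp_lt_delta_of_mem_right (hq : IsReflection K S T p Q q)
    (hST : IsAppropriate L K S T) (hK : IsTransitiveModel K) (hω : CorrectOmegaOne K)
    (hQ : Q ∈ S ∪ T) {N : ZFSet.{u}} (hM : M ∈ q.nodes) (hMS : M ∈ S)
    (hN : N ∈ p.nodes) (hNS : N ∈ S) (h : delta N < delta M) : otp K N < delta M := by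
  have hQ' := hST.isElemSub hQ
  have hM' := hST.isElemSub (Or.inl hMS)
  have hN' := hST.isElemSub (Or.inl hNS)
  -- The height is evaluated at α = 0, which belongs to every node, so its value at δ(N) bounds the
  -- order types of all small nodes with that trace.
  have hN0 : (0 : Ordinal.{u}).toZFSet ∈ N := by
    rw [Ordinal.toZFSet_zero]
    exact hN'.empty_mem hK
  have hNδ := (hN'.toZFSet_delta hK hω).symm
  obtain ⟨β, hβ⟩ := exists_height (K := K) hN hNS hN0 hNδ
  have hpair : ZFSet.pair (0 : Ordinal.{u}).toZFSet (delta N).toZFSet ∈ Q := by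
    refine hQ'.pair_mem hK ?_ (hST.small_subset hK hω hMS hQ
      (hQ'.node_mem hK hω hq.code_mem hM) ?_)
    · rw [Ordinal.toZFSet_zero]
      exact hQ'.empty_mem hK
    · exact (hM'.toZFSet_mem_iff hK hω
        (hN'.delta_lt hK hω (hST.small_countable N hNS))).2 h
  obtain ⟨P, hP, hPS, -, hPδ, rfl⟩ := (hq.height_extends _ _ _ hβ hpair).1
  have hd : delta P = delta N := by rw [delta, hPδ, Ordinal.rank_toZFSet]
  exact (hβ.2 ⟨N, hN, hNS, hN0, hNδ, rfl⟩).trans_lt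
    (hq.cond.otp_lt_delta hST hK hω hM hMS hP hPS (hd ▸ h))

theorem IsReflection.isCond (hq : IsReflection K S T p Q q) (hST : IsAppropriate L K S T)
    (hK : IsTransitiveModel K) (hω : CorrectOmegaOne K) (hp : IsCond K S T p)
    (hQp : Q ∈ p.nodes) : IsCond K S T (amalgamPair S T p q) := by
  have hQ := hp.decorated.side.node Q hQp
  -- The clause depends on the larger node only through its δ and on the smaller one monotonically
  -- through its order type, so new nodes may be replaced by the small nodes of p that include them.
  have hrep : ∀ X ∈ (amalgamPair S T p q).nodes, X ∈ S →
      ∃ Y ∈ S, (Y ∈ p.nodes ∨ Y ∈ q.nodes) ∧ X ⊆ Y ∧ delta X = delta Y := by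
    intro X hX hXS
    rcases hST.mem_right_or_exists_left hK hω hX hXS with h | ⟨M, hM, hMS, hXM, he⟩
    · exact ⟨X, hXS, Or.inr h, fun _ h => h, rfl⟩
    · exact ⟨M, hMS, Or.inl hM, hXM, by rw [delta, he, delta]⟩
  refine ⟨hq.isDecorated hST hK hω hp hQp, fun M hM hMS N hN hNS h => ?_⟩
  have hM' := hST.isElemSub (Or.inl hMS)
  have hN' := hST.isElemSub (Or.inl hNS)
  rw [hM'.toZFSet_mem_iff hK hω (otp_lt_omegaOne (hST.small_countable N hNS))]
  rw [← hN'.toZFSet_delta hK hω,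
    hM'.toZFSet_mem_iff hK hω (hN'.delta_lt hK hω (hST.small_countable N hNS))] at h
  obtain ⟨M₁, hM₁S, hM₁, -, hMd⟩ := hrep M hM hMS
  obtain ⟨N₁, hN₁S, hN₁, hsub, hNd⟩ := hrep N hN hNS
  rw [hMd, hNd] at h
  rw [hMd]
  refine (otp_mono hsub).trans_lt ?_
  rcases hM₁ with hM₁ | hM₁ <;> rcases hN₁ with hN₁ | hN₁
  · exact hp.otp_lt_delta hST hK hω hM₁ hM₁S hN₁ hN₁S h
  · exact hq.otp_lt_delta_of_mem_left hST hK hω hp hQp hM₁ hM₁S hN₁ hN₁S h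
  · exact hq.otp_lt_delta_of_mem_right hST hK hω hQ hM₁ hM₁S hN₁ hN₁S h
  · exact hq.cond.otp_lt_delta hST hK hω hM₁ hM₁S hN₁ hN₁S h

theorem IsReflection.extends_left (hq : IsReflection K S T p Q q) (hST : IsAppropriate L K S T)
    (hK : IsTransitiveModel K) (hω : CorrectOmegaOne K) (hQ : Q ∈ S ∪ T) :
    Extends K S (amalgamPair S T p q) p where
  nodes_subset := subset_amalgam_left
  deco_subset M _ := by
    by_cases h : M ∈ q.nodes
    · rw [amalgamPair_deco_of_mem h]
      exact hq.deco_subset M h ((hST.isElemSub hQ).node_mem hK hω hq.code_mem h)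
    · rw [amalgamPair_deco_of_notMem h]
  height_extends _ _ _ h := hq.height_left hST hK hω hQ h

theorem IsReflection.extends_right (hq : IsReflection K S T p Q q) (hST : IsAppropriate L K S T)
    (hK : IsTransitiveModel K) (hω : CorrectOmegaOne K) (hQ : Q ∈ S ∪ T) :
    Extends K S (amalgamPair S T p q) q where
  nodes_subset := subset_amalgam_right
  deco_subset M h := by rw [amalgamPair_deco_of_mem h]
  height_extends _ _ _ h := hq.height_right hST hK hω hQ h

end Amalgamation
end TwoTypes

theorem mainTheorem4 {L : FirstOrder.Language.{v, w}} (K : ZFSet.{u})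
    [L.Structure (TwoTypes.Carrier K)]
    (hK : TwoTypes.IsTransitiveModel K) (hω : TwoTypes.CorrectOmegaOne K)
    (S T : Set ZFSet.{u}) (hST : TwoTypes.IsAppropriate L K S T)
    (p : TwoTypes.DecPair.{u}) (hp : TwoTypes.IsCond K S T p)
    (Q : ZFSet.{u}) (hQp : Q ∈ p.nodes)
    (hQ : Q ∈ TwoTypes.starFamily L K S T S ∪ TwoTypes.starFamily L K S T T)
    (q : TwoTypes.DecPair.{u}) (hq : TwoTypes.IsReflection K S T p Q q) :
    ∃ r : TwoTypes.DecPair.{u}, TwoTypes.IsCond K S T r ∧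
      TwoTypes.Extends K S r p ∧ TwoTypes.Extends K S r q ∧
      (∀ M, M ∈ r.nodes ↔ TwoTypes.InterClosure {N | N ∈ p.nodes ∨ N ∈ q.nodes} M) ∧
      (∀ M, (M ∈ r.nodes ∧ M ∈ Q) ↔ M ∈ q.nodes) ∧
      (∀ N ∈ r.nodes, N ∈ S → N ∉ Q →
        ∃ M ∈ p.nodes, M ∈ S ∧ (N = M ∨ ∃ W ∈ q.nodes, W ∈ T ∧ N = M ∩ W)) := by
  have hF := hST.modelFamily hK hω
  have hD := hq.amalgamable hST hK hω hp hQp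
  have hQ' : Q ∈ S ∪ T := hQ.imp And.left And.left
  refine ⟨TwoTypes.amalgamPair S T p q, hq.isCond hST hK hω hp hQp,
    hq.extends_left hST hK hω hQ', hq.extends_right hST hK hω hQ',
    fun M => hD.mem_interClosure_iff hF, fun M => hD.mem_amalgam_and_mem_iff hF, ?_⟩
  intro N hN hNS hNQ
  rcases TwoTypes.mem_amalgam.1 hN with h | h | ⟨M, hM, hMS, W, hW, hWT, rfl⟩
  · exact ⟨N, h, hNS, Or.inl rfl⟩
  · exact absurd (hD.mem_node N h) hNQ
  · exact ⟨M, hM, hMS, Or.inr ⟨W, hW, hWT, rfl⟩⟩
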